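/- **Definitions.** For metric spaces $X,Y$ let $c_Y(X)=\inf\{\|f\|_{\mathrm{Lip}}\|f^{-1}\|_{\mathrm{Lip}} : f:X\hookrightarrow Y\}$ and $c_p(X)=c_{L_p[0,1]}(X)$. Let $B_k$ be the complete binary tree of depth $k$ with unit edge lengths and $\mathscr B_X(c)=\max\{k\in\mathbb N: c_X(B_k)<c\}$. For $p>0$ let $\Pi_p(X)\in[0,\infty]$ be the least $\Pi$ such that for every Markov chain $(X_t)_{t\ge 0}$ on a discrete state space $\Omega$, every $f:\Omega\to X$ and every $m\in\mathbb N$, $$\sum_{k=0}^m\sum_{t=1}^{2^m}\frac{\mathbb E\big[d(f(X_t),f(\widetilde X_t(t-2^k)))^p\big]}{2^{kp}}\le \Pi^p\sum_{t=1}^{2^m}\mathbb E\big[d(f(X_t),f(X_{t-1}))^p\big],$$ where $\widetilde X_t(s)$ is the process that equals $X_t$ for $t\le \max\{s,0\}$ and afterwards evolves independently with the same transition probabilities. A rooted tree with positive edge lengths and path metric $d_T$ is an $(\varepsilon,\delta)$-weak prototype with height ratio $R$ if every non-leaf vertex has one or two children; the longest root-leaf path is at most $R$ times as long as the shortest; and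 for every root-leaf path, from $u$ to $v$, if $u_1,\dots,u_m$ are its vertices with at least two children, in order, then the consecutive distances in $(u,u_1,\dots,u_m,v)$ that are at most $\delta\, d_T(u,v)$ sum to at least $\varepsilon\, d_T(u,v)$. A spherically symmetric tree with downward degree sequence $(s_0,\dots,s_h)$, $s_h=0$, is a rooted tree in which every vertex at depth $j$ has exactly $s_j$ children. Let $S_0=(2)$, let $S_{i+1}$ be the concatenation of $S_i$, $2^i-1$ ones, and $S_i$, and let $\widetilde S_i$ be $S_i$ with its last entry replaced by $0$. The Cantor tree $C_i$ is the spherically symmetric tree with downward degree sequence $\widetilde S_i$ and unit edge lengths. **Statement.** $|C_i|\to\infty$, and the following hold. 1. For every $i\ge 2$, $C_i$ is a $(\tfrac12,2^{-i/3})$-weak prototype with height ratio $1$. 2. There is a universal $\kappa>0$ with $\Pi_p(C_i)\ge(\kappa i)^{1/p}$ for all $p\in(0,\infty)$ and all $i\ge 0$; in particular $\Pi_p(C_i)\ge\Omega(i^{1/p})$. 3. For every $c>1$ there is $K=K(c)$ with $\mathscr B_{C_i}(c)\le K i$ for all $i\ge 0$. 4. For every $p\in(1,\infty)$ and $c>1$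 there are $\kappa_1=\kappa_1(p)>0$, $\kappa_2=\kappa_2(c)>0$ and $\kappa_3=\kappa_3(p,c)>0$ such that for all $i\ge 0$, $$c_p(C_i)\ge \kappa_1\,\Pi_{\max\{2,p\}}(C_i),\qquad \Pi_{\max\{2,p\}}(C_i)\ge \kappa_2\,\mathscr B_{C_i}(c)^{\min\{1/p,1/2\}},\qquad c_p(C_i)\ge\kappa_3\,\mathscr B_{C_i}(c)^{\min\{1/p,1/2\}}.$$ 5. Consequently the upper bound $c_p(T)\le 130\left(\frac{c}{c-1}\mathscr B_T(c)\right)^{\min\{1/p,1/2\}}$, valid for all metric trees $T$, has the optimal dependence on $\mathscr B_T(c)$: for all $p\in(1,\infty)$, $c>1$ and every $g:\mathbb N\to\mathbb R$ with $g(k)=o(k^{\min\{1/p,1/2\}})$ there is an $i$ with $c_p(C_i)>g(\mathscr B_{C_i}(c))$. -/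

import Mathlib

open scoped ENNReal NNReal

noncomputable section

namespace CantorTree

/-! ### Bi-Lipschitz distortion -/

/-- The distortion `‖f‖_Lip * ‖f⁻¹‖_Lip` of an (injective) map between metric spaces, where
`f⁻¹` is defined on the range of `f`. -/
def mapDistortion {X Y : Type*} [EDist X] [EDist Y] (f : X → Y) : ℝ≥0∞ :=
  (⨆ (x : X) (y : X) (_ : x ≠ y), edist (f x) (f y) / edist x y) *
    (⨆ (x : X) (y : X) (_ : x ≠ y), edist x y / edist (f x) (f y))

/-- `distortion X Y` is `c_Y(X)`, the infimum of the distortions of all injections `X → Y`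
(it is `∞` if no injection has finite distortion). -/
def distortion (X Y : Type*) [EDist X] [EDist Y] : ℝ≥0∞ :=
  ⨅ (f : X → Y) (_ : Function.Injective f), mapDistortion f

/-- `lpDistortion p X` is `c_p(X)`, the distortion of `X` into the real space `L_p[0,1]`. -/
def lpDistortion (p : ℝ) (X : Type*) [EDist X] : ℝ≥0∞ :=
  distortion X (MeasureTheory.Lp ℝ (ENNReal.ofReal p)
    (MeasureTheory.volume.restrict (Set.Icc (0 : ℝ) 1)))

/-! ### Markov convexity

A Markov chain on a discrete state space `Ω` is given by the law `init` of `X_0` and the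
transition probabilities `step`. -/

section Markov

variable {Ω : Type}

/-- The law of `X_t`. -/
def chainLaw (init : PMF Ω) (step : Ω → PMF Ω) : ℕ → PMF Ω
  | 0 => init
  | t + 1 => (chainLaw init step t).bind step

/-- The joint law of `(X_t, X_{t+1})`. -/
def stepLaw (init : PMF Ω) (step : Ω → PMF Ω) (t : ℕ) : PMF (Ω × Ω) :=
  (chainLaw init step t).bind fun x => (step x).map fun y => (x, y)

/-- The joint law, for `s ≤ t`, of `(X_t, X̃_t(s))`: both chains agree up to time `s`, and run
independently with the same transition probabilities for the remaining `t - s` steps. -/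
def splitLaw (init : PMF Ω) (step : Ω → PMF Ω) (s t : ℕ) : PMF (Ω × Ω) :=
  (chainLaw init step s).bind fun x =>
    (chainLaw (PMF.pure x) step (t - s)).bind fun y =>
      (chainLaw (PMF.pure x) step (t - s)).map fun z => (y, z)

/-- The expectation of a `[0,∞]`-valued function. -/
def expect {α : Type*} (μ : PMF α) (g : α → ℝ≥0∞) : ℝ≥0∞ := ∑' a, μ a * g a

end Markov

/-- `X` is Markov `p`-convex with constant `C`. The subtraction `t - 2 ^ k` is truncated: for
`t < 2 ^ k` the two chains have the same starting point `X_0` and run independently from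
time `0` on. -/
def IsMarkovConvexWith (X : Type*) [EDist X] (p : ℝ) (C : ℝ≥0) : Prop :=
  ∀ (Ω : Type) (init : PMF Ω) (step : Ω → PMF Ω) (f : Ω → X) (m : ℕ),
    ∑ k ∈ Finset.range (m + 1), ∑ t ∈ Finset.Icc 1 (2 ^ m),
        expect (splitLaw init step (t - 2 ^ k) t) (fun z => edist (f z.1) (f z.2) ^ p) /
          (2 : ℝ≥0∞) ^ ((k : ℝ) * p)
      ≤ (C : ℝ≥0∞) ^ p *
        ∑ t ∈ Finset.Icc 1 (2 ^ m),
          expect (stepLaw init step (t - 1)) (fun z => edist (f z.2) (f z.1) ^ p)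

/-- The Markov `p`-convexity constant `Π_p(X)`. -/
def markovConvexity (p : ℝ) (X : Type*) [EDist X] : ℝ≥0∞ :=
  ⨅ (C : ℝ≥0) (_ : IsMarkovConvexWith X p C), (C : ℝ≥0∞)

/-! ### Weighted rooted trees and weak prototypes -/

section Prototype

variable {V : Type*}

/-- The shortest path metric induced by the edge lengths `ℓ`. -/
def pathDist (G : SimpleGraph V) (ℓ : Sym2 V → ℝ) (u v : V) : ℝ :=
  ⨅ w : G.Walk u v, (w.edges.map ℓ).sum

/-- The children of `v` in the tree `G` rooted at `r`. -/
def children (G : SimpleGraph V) (r v : V) : Set V :=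
  {w | G.Adj v w ∧ G.dist r w = G.dist r v + 1}

/-- A leaf is a vertex without children. -/
def IsLeaf (G : SimpleGraph V) (r v : V) : Prop := children G r v = ∅

/-- A path metric whose successive edges have lengths `L` is `(ε, δ)`-weak if at least an
`ε`-fraction of its length consists of edges of length at most `δ` times its length. -/
def IsWeakPath (ε δ : ℝ) (L : List ℝ) : Prop :=
  ε * L.sum ≤ (L.filter fun x => x ≤ δ * L.sum).sum

open Classical in
/-- The vertices `(u, u₁, …, u_m, v)`, where `u₁, …, u_m` are the vertices, in order, of the
path `P` from `u` to `v` which have at least two children. -/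
def branchList (G : SimpleGraph V) (r : V) {u v : V} (P : G.Walk u v) : List V :=
  u :: (P.support.filter fun x => 2 ≤ (children G r x).encard) ++ [v]

/-- The path `P` is degree-2 `(ε, δ)`-weak. -/
def IsDegreeTwoWeak (G : SimpleGraph V) (r : V) (ℓ : Sym2 V → ℝ) (ε δ : ℝ) {u v : V}
    (P : G.Walk u v) : Prop :=
  IsWeakPath ε δ
    (List.zipWith (pathDist G ℓ) (branchList G r P) (branchList G r P).tail)

/-- The graph `G` with root `r` and edge lengths `ℓ` is a tree which is an `(ε, δ)`-weak
prototype with height ratio `R`. -/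
structure IsWeakPrototype (G : SimpleGraph V) (r : V) (ℓ : Sym2 V → ℝ) (ε δ R : ℝ) : Prop where
  isTree : G.IsTree
  length_pos : ∀ e ∈ G.edgeSet, 0 < ℓ e
  one_or_two_children : ∀ v, ¬ IsLeaf G r v →
    (children G r v).encard = 1 ∨ (children G r v).encard = 2
  root_leaf_weak : ∀ (v : V) (P : G.Walk r v), IsLeaf G r v → P.IsPath →
    IsDegreeTwoWeak G r ℓ ε δ P
  height_ratio : ∀ v w, IsLeaf G r v → IsLeaf G r w → pathDist G ℓ r v ≤ R * pathDist G ℓ r w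

end Prototype

/-! ### Spherically symmetric trees -/

/-- The vertices of the spherically symmetric tree with downward degree sequence `s` (which ends
in `0`). A vertex is the list of choices of children on the way to it from the root `[]`; a
vertex at depth `j` has `s_j` children. -/
def SST (s : List ℕ) : Type :=
  {l : List ℕ // ∀ (j : ℕ) (h : j < l.length), l[j] < s.getD j 0}

namespace SST

variable {s : List ℕ}

/-- The root. -/
def root (s : List ℕ) : SST s := ⟨[], fun j h => absurd h (Nat.not_lt_zero j)⟩

/-- The tree as a graph: the edges join a vertex to its children. -/
def graph (s : List ℕ) : SimpleGraph (SST s) where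
  Adj u v := (∃ a, v.1 = u.1 ++ [a]) ∨ (∃ a, u.1 = v.1 ++ [a])
  symm := ⟨fun _ _ h => h.symm⟩
  loopless := ⟨fun u h => by
    rcases h with ⟨a, h⟩ | ⟨a, h⟩ <;> simpa using congrArg List.length h⟩

theorem reachable_root (l : List ℕ) (hl : ∀ (j : ℕ) (h : j < l.length), l[j] < s.getD j 0) :
    (graph s).Reachable (root s) ⟨l, hl⟩ := by
  induction l using List.reverseRecOn with
  | nil => exact SimpleGraph.Reachable.refl _
  | append_singleton l a ih =>
    have hl' : ∀ (j : ℕ) (h : j < l.length), l[j] < s.getD j 0 := fun j h => by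
      have := hl j (by simp; omega)
      rwa [List.getElem_append_left h] at this
    refine (ih hl').trans (SimpleGraph.Adj.reachable ?_)
    exact Or.inl ⟨a, rfl⟩

theorem connected (s : List ℕ) : (graph s).Connected :=
  { preconnected := fun u v => (reachable_root u.1 u.2).symm.trans (reachable_root v.1 v.2)
    nonempty := ⟨root s⟩ }

/-- The shortest path metric with unit edge lengths. -/
instance : MetricSpace (SST s) where
  dist u v := ((graph s).dist u v : ℝ)
  dist_self u := by simp
  dist_comm u v := by rw [SimpleGraph.dist_comm]
  dist_triangle u v w := by exact_mod_cast (connected s).dist_triangle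
  eq_of_dist_eq_zero {u v} h := (connected s).dist_eq_zero_iff.1 (by exact_mod_cast h)

end SST

/-- The complete binary tree `B_k` of depth `k`, with unit edge lengths. -/
abbrev BinaryTree (k : ℕ) : Type := SST (List.replicate k 2 ++ [0])

/-- `binaryDepth X c` is `𝓑_X(c)`, the largest `k` such that `c_X(B_k) < c` (`∞` if there are
arbitrarily large such `k`). -/
def binaryDepth (X : Type*) [EDist X] (c : ℝ) : ℕ∞ :=
  ⨆ (k : ℕ) (_ : distortion (BinaryTree k) X < ENNReal.ofReal c), (k : ℕ∞)

/-! ### Cantor trees -/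

/-- The sequences `S_i`. -/
def cantorSeq : ℕ → List ℕ
  | 0 => [2]
  | i + 1 => cantorSeq i ++ List.replicate (2 ^ i - 1) 1 ++ cantorSeq i

/-- `S_i` with its last element replaced by `0`. -/
def cantorDegrees (i : ℕ) : List ℕ := (cantorSeq i).dropLast ++ [0]

/-- The Cantor tree `C_i`, with unit edge lengths. -/
abbrev Cantor (i : ℕ) : Type := SST (cantorDegrees i)

end CantorTree

end

noncomputable section

namespace CantorTree

/-! The branching levels of C_i form a discrete Cantor set. Passing from S_m to S_{m+1} puts a gap
of length 2^m between two copies of S_m, so S_i has 2^(i-1-m) gaps of length 2^m, and together they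
cover 2^(i-1) levels for every m < i. All i scales have the same share of the height i·2^(i-1), and
the claims rest on this balance.

Weak prototypes: the gaps of length at most 2^⌊i/2⌋ fill at least half of a root-leaf path
(`le_sum_filter_gaps`), and this length is at most 2^(-i/3) times the height.

Markov convexity (`le_markovConvexity_cantor`): the test chain is the random descent from the root.
If a branching level lies between t - 2^(k+1) and t - 2^k, two copies split at time t - 2^(k+1)
separate there with probability 1/2 and are then at distance at least 2^(k+1) at time t. At scale k
this happens for at least a fraction (k+1)/(2i) of the times up to the height, and summing over k <
i makes the left side at least of order i times the right side.

Binary trees (`depth_le_of_biLipschitz`): a vertical segment of length height(j) + 2·2^j contains a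
stretch of length 2^j without branching. If 2^j is a large enough multiple of the Lipschitz
constant, an embedded binary tree crossing this stretch would map a ball with 2^q points into a
path, where only O(cq) points of such a ball fit. Hence the image of a longest root-leaf path of B_k
joins points at distance O(i·2^j), and k = O(i).

Distortion (`markovConvexity_le_lpDistortion`): L_p is uniformly convex with exponent q = max{2,p}.
This yields a four-point inequality which telescopes over dyadic scales to Markov q-convexity
(`IsForkConvex.isMarkovConvexWith`). Markov convexity constants grow at most by the distortion, so
c_p(C_i) is at least of order i^(1/q), while the binary depth is O(i). Comparing the two gives the
chain of inequalities and its sharpness. -/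

/-! ### The metric of a spherically symmetric tree -/

/-- The tree distance of two vertices, given as words: the number of letters after their longest
common prefix. -/
def wordDist : List ℕ → List ℕ → ℕ
  | [], l => l.length
  | _ :: l, [] => l.length + 1
  | a :: l, b :: l' => if a = b then wordDist l l' else l.length + l'.length + 2

theorem wordDist_self (l : List ℕ) : wordDist l l = 0 := by
  induction l with
  | nil => simp [wordDist]
  | cons a l ih => simp [wordDist, ih]

theorem wordDist_append_singleton_le (l l' : List ℕ) (a : ℕ) :
    wordDist (l ++ [a]) l' ≤ wordDist l l' + 1 := by
  induction l generalizing l' with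
  | nil =>
    cases l' with
    | nil => simp [wordDist]
    | cons b l' =>
      simp only [List.nil_append, wordDist]
      split_ifs
      · simp; omega
      · simp
  | cons c l ih =>
    cases l' with
    | nil => simp [wordDist]
    | cons b l' =>
      simp only [List.cons_append, wordDist]
      split_ifs
      · exact ih l'
      · simp; omega

theorem wordDist_le_append_singleton (l l' : List ℕ) (a : ℕ) :
    wordDist l l' ≤ wordDist (l ++ [a]) l' + 1 := by
  induction l generalizing l' with
  | nil =>
    cases l' with
    | nil => simp [wordDist]
    | cons b l' =>
      simp only [List.nil_append, wordDist]
      split_ifs <;> simp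
  | cons c l ih =>
    cases l' with
    | nil => simp [wordDist]
    | cons b l' =>
      simp only [List.cons_append, wordDist]
      split_ifs
      · exact ih l'
      · simp; omega

theorem exists_wordDist_eq (l l' : List ℕ) : ∃ w x y, l = w ++ x ∧ l' = w ++ y ∧
    wordDist l l' = x.length + y.length := by
  induction l generalizing l' with
  | nil => exact ⟨[], [], l', by simp [wordDist]⟩
  | cons a l ih =>
    cases l' with
    | nil => exact ⟨[], a :: l, [], by simp [wordDist]⟩
    | cons b l' =>
      by_cases h : a = b
      · obtain ⟨w, x, y, rfl, rfl, h3⟩ := ih l'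
        exact ⟨a :: w, x, y, by simp, by simp [h], by simp [wordDist, h, h3]⟩
      · exact ⟨[], a :: l, b :: l', by simp, by simp, by simp [wordDist, h]; omega⟩

theorem wordDist_append_append (w x y : List ℕ) :
    wordDist (w ++ x) (w ++ y) = wordDist x y := by
  induction w with
  | nil => simp
  | cons a w ih => simp [wordDist, ih]

theorem wordDist_of_prefix {l l' : List ℕ} (h : l <+: l') :
    wordDist l l' = l'.length - l.length := by
  obtain ⟨x, rfl⟩ := h
  have := wordDist_append_append l [] x
  simp [wordDist] at this ⊢
  omega

/-- The common prefix has length at most a, and the path between the two words climbs back to it. -/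
theorem le_wordDist_of_getElem?_ne {l l' : List ℕ} {a : ℕ} (h : l[a]? ≠ l'[a]?) :
    l.length + l'.length ≤ wordDist l l' + 2 * a := by
  obtain ⟨w, x, y, rfl, rfl, h3⟩ := exists_wordDist_eq l l'
  have : w.length ≤ a := by
    by_contra hlt
    push Not at hlt
    simp [List.getElem?_append_left hlt] at h
  simp only [List.length_append]
  omega

namespace SST

variable {s : List ℕ}

/-- The prefix of length `n` of a vertex. -/
def take (v : SST s) (n : ℕ) : SST s :=
  ⟨v.1.take n, fun j h => by
    have h' : j < v.1.length := by simp at h; omega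
    simpa using v.2 j h'⟩

/-- The child `a` of a vertex. -/
def snoc (v : SST s) (a : ℕ) (h : a < s.getD v.1.length 0) : SST s :=
  ⟨v.1 ++ [a], fun j hj => by
    rcases Nat.lt_or_ge j v.1.length with h' | h'
    · simpa [List.getElem_append_left h'] using v.2 j h'
    · have : j = v.1.length := by simp at hj; omega
      subst this
      simpa using h⟩

theorem lt_of_val_eq_append {u v : SST s} {a : ℕ} (h : v.1 = u.1 ++ [a]) :
    a < s.getD u.1.length 0 := by
  have := v.2 u.1.length (by simp [h])
  simpa [h] using this

theorem wordDist_le_dist (u v : SST s) : wordDist u.1 v.1 ≤ (graph s).dist u v := by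
  obtain ⟨p, hp⟩ := (connected s).exists_walk_length_eq_dist u v
  rw [← hp]
  clear hp
  induction p with
  | nil => simp [wordDist_self]
  | cons h p ih =>
    rename_i x y z
    rw [SimpleGraph.Walk.length_cons]
    rcases h with ⟨a, h⟩ | ⟨a, h⟩
    · have := wordDist_le_append_singleton x.1 z.1 a
      rw [← h] at this
      omega
    · have := wordDist_append_singleton_le y.1 z.1 a
      rw [← h] at this
      omega

theorem dist_take_le (v : SST s) (n k : ℕ) (h : v.1.length = n + k) :
    (graph s).dist (v.take n) v ≤ k := by
  induction k generalizing v with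
  | zero =>
    have : v.take n = v := Subtype.ext (List.take_of_length_le (by omega))
    simp [this]
  | succ k ih =>
    have h1 : (v.take (n + k)).1.length = n + k := by simp [take]; omega
    have h2 := ih _ h1
    have h3 : (v.take (n + k)).take n = v.take n :=
      Subtype.ext (by simp [take, List.take_take])
    rw [h3] at h2
    have h4 : (graph s).Adj (v.take (n + k)) v := by
      refine Or.inl ⟨v.1[n + k], ?_⟩
      simp only [take]
      rw [List.take_append_getElem, List.take_of_length_le (by omega)]
    have h5 := (connected s).dist_triangle (u := v.take n) (v := v.take (n + k)) (w := v)
    have h6 : (graph s).dist (v.take (n + k)) v = 1 := SimpleGraph.dist_eq_one_iff_adj.2 h4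
    omega

/-- An edge adds or deletes one last letter, so `wordDist` to a fixed word changes by at most one
along it; this bounds every walk from below. The walk through the longest common prefix attains the
bound. -/
theorem graph_dist_eq (u v : SST s) : (graph s).dist u v = wordDist u.1 v.1 := by
  refine le_antisymm ?_ (wordDist_le_dist u v)
  obtain ⟨w, x, y, h1, h2, h3⟩ := exists_wordDist_eq u.1 v.1
  have e : u.take w.length = v.take w.length := Subtype.ext (by simp [take, h1, h2])
  have hu := dist_take_le u w.length x.length (by simp [h1])
  have hv := dist_take_le v w.length y.length (by simp [h2])
  have h5 := (connected s).dist_triangle (u := u) (v := u.take w.length) (w := v)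
  rw [SimpleGraph.dist_comm (u := u) (v := u.take w.length), e] at h5
  rw [e] at hu
  omega

theorem dist_eq (u v : SST s) : dist u v = wordDist u.1 v.1 := by
  rw [← graph_dist_eq]; rfl

theorem edist_eq (u v : SST s) : edist u v = (wordDist u.1 v.1 : ℝ≥0∞) := by
  rw [edist_dist, dist_eq, ENNReal.ofReal_natCast]

theorem graph_dist_root (v : SST s) : (graph s).dist (root s) v = v.1.length := by
  rw [graph_dist_eq]; simp [root, wordDist]

theorem length_le (v : SST s) : v.1.length ≤ s.length := by
  by_contra h
  push Not at h
  have := v.2 s.length h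
  simp at this

/-- Needed for `Nat.card` to be the true size: it is 0 on infinite types. -/
instance : Finite (SST s) := by
  obtain ⟨M, hM⟩ : ∃ M, ∀ j, s.getD j 0 ≤ M := by
    induction s with
    | nil => exact ⟨0, by simp⟩
    | cons a s ih =>
      obtain ⟨M, hM⟩ := ih
      refine ⟨max a M, fun j => ?_⟩
      cases j with
      | zero => simp
      | succ j => exact (by simpa using Or.inr (hM j))
  let F : SST s → (Fin s.length → Option (Fin M)) := fun v j =>
    if h : j.1 < v.1.length then some ⟨v.1[j.1], (v.2 _ h).trans_le (hM _)⟩ else none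
  refine Finite.of_injective F fun u v h => Subtype.ext (List.ext_getElem? fun j => ?_)
  by_cases hj : j < s.length
  · have := congrFun h ⟨j, hj⟩
    simp only [F] at this
    by_cases h1 : j < u.1.length <;> by_cases h2 : j < v.1.length <;>
      simp_all
  · have h1 := u.length_le
    have h2 := v.length_le
    rw [List.getElem?_eq_none (by omega), List.getElem?_eq_none (by omega)]

theorem isAcyclic : (graph s).IsAcyclic := by
  rw [SimpleGraph.isAcyclic_iff_forall_adj_isBridge]
  have key : ∀ (u v : SST s) (a : ℕ), v.1 = u.1 ++ [a] → (graph s).IsBridge s(u, v) := by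
    intro u v a h
    rw [SimpleGraph.isBridge_iff]
    rintro ⟨p⟩
    -- Without the edge from u to v, no walk enters the subtree of words extending v.
    have inv : ∀ x y : SST s, ((graph s) \ SimpleGraph.fromEdgeSet {s(u, v)}).Walk x y →
        ¬ v.1 <+: x.1 → ¬ v.1 <+: y.1 := by
      intro x y p
      induction p with
      | nil => exact id
      | cons hadj p ih =>
        rename_i x y z
        intro hx
        refine ih fun hy => ?_
        obtain ⟨hadj, hne⟩ := hadj
        simp only [SimpleGraph.fromEdgeSet_adj, Set.mem_singleton_iff, not_and, not_not] at hne
        rcases hadj with ⟨b, hb⟩ | ⟨b, hb⟩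
        · rw [hb, List.prefix_concat_iff] at hy
          rcases hy with hy | hy
          · have hyv : y = v := Subtype.ext (hb.trans (by simpa using hy.symm))
            have hxu : x = u := by
              rw [h] at hy
              exact Subtype.ext (List.append_inj' hy rfl).1.symm
            subst hyv hxu
            have := hne rfl
            rw [this] at hx
            exact hx (List.prefix_refl _)
          · exact hx hy
        · exact hx (hy.trans (hb ▸ List.prefix_append _ _))
    refine inv u v p (fun hp => ?_) (List.prefix_refl _)
    have := hp.length_le
    simp [h] at this
  rintro u v (⟨a, h⟩ | ⟨a, h⟩)
  · exact key u v a h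
  · rw [Sym2.eq_swap]; exact key v u a h

theorem isTree : (graph s).IsTree := ⟨connected s, isAcyclic⟩

theorem mem_children {v w : SST s} :
    w ∈ children (graph s) (root s) v ↔ ∃ a, w.1 = v.1 ++ [a] := by
  simp only [children, Set.mem_ofPred_eq, graph_dist_root]
  constructor
  · rintro ⟨⟨a, h⟩ | ⟨a, h⟩, h'⟩
    · exact ⟨a, h⟩
    · have := congrArg List.length h
      simp at this
      omega
  · rintro ⟨a, h⟩
    exact ⟨Or.inl ⟨a, h⟩, by simp [h]⟩

theorem encard_children (v : SST s) :
    (children (graph s) (root s) v).encard = (s.getD v.1.length 0 : ℕ) := by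
  let F : Fin (s.getD v.1.length 0) → SST s := fun a => v.snoc a.1 a.2
  have hF : Function.Injective F := fun a b h => by
    have := congrArg Subtype.val h
    simpa [F, snoc, Fin.ext_iff] using this
  have : children (graph s) (root s) v = Set.range F := by
    ext w
    rw [mem_children]
    constructor
    · rintro ⟨a, h⟩
      exact ⟨⟨a, lt_of_val_eq_append h⟩, Subtype.ext h.symm⟩
    · rintro ⟨a, rfl⟩
      exact ⟨a.1, rfl⟩
  rw [this, ← Set.image_univ, hF.encard_image, Set.encard_univ]
  simp

theorem isLeaf_iff (v : SST s) : IsLeaf (graph s) (root s) v ↔ s.getD v.1.length 0 = 0 := by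
  rw [IsLeaf, ← Set.encard_eq_zero, encard_children]
  simp

end SST

/-! ### The degree sequences of the Cantor trees -/

/-- The height of the Cantor tree `C_i`. -/
def height : ℕ → ℕ
  | 0 => 0
  | i + 1 => 2 * height i + 2 ^ i

theorem two_mul_height (i : ℕ) : 2 * height i = i * 2 ^ i := by
  induction i with
  | zero => simp [height]
  | succ i ih => rw [height, mul_add, ih]; ring

theorem height_mono : Monotone height :=
  monotone_nat_of_le_succ fun i => by
    rw [height]; exact le_trans (by omega) (Nat.le_add_right _ _)

theorem height_lt_succ (i : ℕ) : height i < height (i + 1) := by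
  have := Nat.two_pow_pos i
  rw [height]; omega

theorem length_cantorSeq (i : ℕ) : (cantorSeq i).length = height i + 1 := by
  induction i with
  | zero => simp [cantorSeq, height]
  | succ i ih =>
    have := Nat.two_pow_pos i
    simp only [cantorSeq, List.length_append, ih, List.length_replicate, height]
    omega

theorem getD_cantorSeq_succ_of_le {i j : ℕ} (h : j ≤ height i) :
    (cantorSeq (i + 1)).getD j 0 = (cantorSeq i).getD j 0 := by
  have hl := length_cantorSeq i
  rw [cantorSeq, List.append_assoc, List.getD_append _ _ _ _ (by omega)]

theorem getD_cantorSeq_succ_mid {i j : ℕ} (h : height i < j) (h' : j < height i + 2 ^ i) :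
    (cantorSeq (i + 1)).getD j 0 = 1 := by
  have hl := length_cantorSeq i
  rw [cantorSeq, List.append_assoc, List.getD_append_right _ _ _ _ (by omega),
    List.getD_append _ _ _ _ (by simp; omega)]
  rw [List.getD_eq_getElem _ _ (by simp; omega)]
  simp

theorem getD_cantorSeq_succ_add (i j : ℕ) :
    (cantorSeq (i + 1)).getD (height i + 2 ^ i + j) 0 = (cantorSeq i).getD j 0 := by
  have hl := length_cantorSeq i
  have := Nat.two_pow_pos i
  rw [cantorSeq, List.getD_append_right _ _ _ _ (by simp; omega)]
  congr 1
  simp; omega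

theorem getD_cantorSeq_of_gt {i j : ℕ} (h : height i < j) : (cantorSeq i).getD j 0 = 0 :=
  List.getD_eq_default _ _ (by rw [length_cantorSeq]; omega)

theorem getD_cantorSeq_eq_one_or_two {i j : ℕ} (h : j ≤ height i) :
    (cantorSeq i).getD j 0 = 1 ∨ (cantorSeq i).getD j 0 = 2 := by
  induction i generalizing j with
  | zero => simp [height] at h; simp [h, cantorSeq]
  | succ i ih =>
    rcases Nat.lt_or_ge (height i) j with h1 | h1
    · rcases Nat.lt_or_ge j (height i + 2 ^ i) with h2 | h2
      · exact Or.inl (getD_cantorSeq_succ_mid h1 h2)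
      · obtain ⟨k, rfl⟩ := Nat.exists_eq_add_of_le h2
        rw [getD_cantorSeq_succ_add]
        rw [height] at h
        exact ih (by omega)
    · rw [getD_cantorSeq_succ_of_le h1]; exact ih h1

theorem getD_cantorSeq_zero (i : ℕ) : (cantorSeq i).getD 0 0 = 2 := by
  induction i with
  | zero => simp [cantorSeq]
  | succ i ih => rw [getD_cantorSeq_succ_of_le (Nat.zero_le _), ih]

theorem getD_cantorSeq_height (i : ℕ) : (cantorSeq i).getD (height i) 0 = 2 := by
  induction i with
  | zero => simp [cantorSeq, height]
  | succ i ih =>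
    have : height (i + 1) = height i + 2 ^ i + height i := by rw [height]; omega
    rw [this, getD_cantorSeq_succ_add, ih]

theorem getD_cantorDegrees_of_lt {i j : ℕ} (h : j < height i) :
    (cantorDegrees i).getD j 0 = (cantorSeq i).getD j 0 := by
  have hl := length_cantorSeq i
  rw [cantorDegrees, List.getD_append _ _ _ _ (by simp; omega),
    List.getD_eq_getElem _ _ (by simp; omega), List.getD_eq_getElem _ _ (by omega)]
  simp

theorem getD_cantorDegrees_of_ge {i j : ℕ} (h : height i ≤ j) :
    (cantorDegrees i).getD j 0 = 0 := by
  have hl := length_cantorSeq i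
  rw [cantorDegrees, List.getD_append_right _ _ _ _ (by simp; omega)]
  rcases Nat.eq_zero_or_pos (j - (cantorSeq i).dropLast.length) with h0 | h0
  · rw [h0]; rfl
  · exact List.getD_eq_default _ _ h0

theorem getD_cantorDegrees_le (i j : ℕ) :
    (cantorDegrees i).getD j 0 ≤ (cantorSeq i).getD j 0 := by
  rcases Nat.lt_or_ge j (height i) with h | h
  · rw [getD_cantorDegrees_of_lt h]
  · rw [getD_cantorDegrees_of_ge h]; exact Nat.zero_le _

theorem getD_cantorDegrees_pos_iff {i j : ℕ} : 0 < (cantorDegrees i).getD j 0 ↔ j < height i := by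
  rcases Nat.lt_or_ge j (height i) with h | h
  · rw [getD_cantorDegrees_of_lt h]
    rcases getD_cantorSeq_eq_one_or_two h.le with h' | h' <;> (rw [h']; simp [h])
  · rw [getD_cantorDegrees_of_ge h]; simp [h]

theorem Cantor.length_le {i : ℕ} (v : Cantor i) : v.1.length ≤ height i := by
  by_contra h
  push Not at h
  have := v.2 (height i) h
  rw [getD_cantorDegrees_of_ge le_rfl] at this
  omega

/-- The leftmost vertex of depth `n`. -/
def Cantor.leftmost (i n : ℕ) (h : n ≤ height i) : Cantor i :=
  ⟨List.replicate n 0, fun j hj => by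
    simp only [List.length_replicate] at hj
    simpa using getD_cantorDegrees_pos_iff.2 (hj.trans_le h)⟩

theorem tendsto_card_cantor :
    Filter.Tendsto (fun i => Nat.card (Cantor i)) Filter.atTop Filter.atTop := by
  have h1 : ∀ i, i ≤ height i := by
    intro i
    induction i with
    | zero => simp
    | succ i ih => have := height_lt_succ i; omega
  refine Filter.tendsto_atTop_mono (fun i => ?_) Filter.tendsto_id
  let F : Fin (height i + 1) → Cantor i := fun n => Cantor.leftmost i n.1 (by omega)
  have hF : Function.Injective F := fun a b h => by
    have := congrArg (fun v => v.1.length) h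
    simpa [F, Cantor.leftmost, Fin.ext_iff] using this
  have := Nat.card_le_card_of_injective F hF
  simp only [Nat.card_eq_fintype_card (α := Fin _), Fintype.card_fin] at this
  have := h1 i
  simp only [id]
  omega

/-! ### Gaps between the branching levels -/

open Classical in
/-- The number of levels `x` below `height i` such that one of the `2 ^ k` levels up to `x`, or the
level `2 ^ k` steps before `x`, is branching. -/
def nearCount (i k : ℕ) : ℕ :=
  ((Finset.range (height i)).filter fun x =>
    ∃ a, (cantorSeq i).getD a 0 = 2 ∧ a ≤ x ∧ x ≤ a + 2 ^ k).card

/-- The widest gap between branching levels in S_{i+1} is the middle one, of length 2^i. -/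
theorem exists_near (i x : ℕ) (hx : x ≤ height (i + 1)) :
    ∃ a, (cantorSeq (i + 1)).getD a 0 = 2 ∧ a ≤ x ∧ x ≤ a + 2 ^ i := by
  induction i generalizing x with
  | zero =>
    exact ⟨0, getD_cantorSeq_zero _, Nat.zero_le _, by simpa [height] using hx⟩
  | succ i ih =>
    rcases Nat.lt_or_ge x (height (i + 1) + 2 ^ (i + 1)) with h | h
    · rcases Nat.lt_or_ge x (height (i + 1)) with h1 | h1
      · obtain ⟨a, h2, h3, h4⟩ := ih x h1.le
        refine ⟨a, ?_, h3, h4.trans ?_⟩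
        · rw [getD_cantorSeq_succ_of_le (by omega), h2]
        · rw [pow_succ]; omega
      · refine ⟨height (i + 1), ?_, h1, by omega⟩
        rw [getD_cantorSeq_succ_of_le le_rfl, getD_cantorSeq_height]
    · obtain ⟨y, rfl⟩ := Nat.exists_eq_add_of_le h
      have h0 : height (i + 1 + 1) = 2 * height (i + 1) + 2 ^ (i + 1) := rfl
      obtain ⟨a, h2, h3, h4⟩ := ih y (by omega)
      refine ⟨height (i + 1) + 2 ^ (i + 1) + a, ?_, by omega, ?_⟩
      · rw [getD_cantorSeq_succ_add, h2]
      · have : 2 ^ i ≤ 2 ^ (i + 1) := Nat.pow_le_pow_right (by norm_num) (by omega)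
        omega

/-- The two copies of S_i inside S_{i+1} contribute disjoint sets of levels, one the translate of
the other. -/
theorem nearCount_succ (i k : ℕ) : 2 * nearCount i k ≤ nearCount (i + 1) k := by
  classical
  set A := (Finset.range (height i)).filter fun x =>
    ∃ a, (cantorSeq i).getD a 0 = 2 ∧ a ≤ x ∧ x ≤ a + 2 ^ k with hA
  have hA' : ∀ x ∈ A, x < height i ∧
      ∃ a, (cantorSeq i).getD a 0 = 2 ∧ a ≤ x ∧ x ≤ a + 2 ^ k := by
    intro x hx
    simpa [hA] using hx
  set g := height i + 2 ^ i with hg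
  have hdisj : Disjoint A (A.image fun x => g + x) := by
    rw [Finset.disjoint_left]
    intro x hx hx'
    obtain ⟨y, -, rfl⟩ := Finset.mem_image.1 hx'
    have := (hA' _ hx).1
    have := Nat.two_pow_pos i
    omega
  have hcard : (A ∪ A.image fun x => g + x).card = 2 * nearCount i k := by
    rw [Finset.card_union_of_disjoint hdisj,
      Finset.card_image_of_injective _ (fun a b h => by simpa using h), nearCount, ← hA]
    ring
  rw [← hcard, nearCount]
  refine Finset.card_le_card fun x hx => ?_
  rw [Finset.mem_filter, Finset.mem_range, height]
  have := Nat.two_pow_pos i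
  rcases Finset.mem_union.1 hx with hx | hx
  · obtain ⟨h1, a, h2, h3, h4⟩ := hA' x hx
    exact ⟨by omega, a, by rw [getD_cantorSeq_succ_of_le (by omega), h2], h3, h4⟩
  · obtain ⟨y, hy, rfl⟩ := Finset.mem_image.1 hx
    obtain ⟨h1, a, h2, h3, h4⟩ := hA' y hy
    exact ⟨by omega, g + a, by rw [getD_cantorSeq_succ_add, h2], by omega, by omega⟩

/-- In S_{k+1} every level counts, which gives height(k+1) = (k+1)·2^k; each of the n further
doublings doubles the count. -/
theorem le_nearCount (n k : ℕ) : (k + 1) * 2 ^ (k + n) ≤ nearCount (k + 1 + n) k := by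
  classical
  induction n with
  | zero =>
    have h1 : nearCount (k + 1) k = height (k + 1) := by
      rw [nearCount, Finset.filter_true_of_mem, Finset.card_range]
      intro x hx
      exact exists_near k x (Finset.mem_range.1 hx).le
    have h2 := two_mul_height (k + 1)
    rw [pow_succ] at h2
    simp only [add_zero]
    rw [h1]
    nlinarith
  | succ n ih =>
    refine le_trans ?_ (nearCount_succ (k + 1 + n) k)
    rw [← add_assoc, pow_succ]
    linarith

/-- Levels are integers here: nothing branches below 0 or beyond the height, so a window may stick
out of the sequence and the induction can translate it into the right copy. The inserted gap, of
length 2^(j+i) ≥ 2^j, serves windows that straddle both copies. -/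
theorem exists_free (j i : ℕ) (a : ℤ) : ∃ y : ℤ, a ≤ y ∧ y ≤ a + height j + 2 ^ j ∧
    ∀ z : ℕ, y < z → (z : ℤ) < y + 2 ^ j → (cantorSeq (j + i)).getD z 0 ≠ 2 := by
  induction i generalizing a with
  | zero =>
    have hp : (0 : ℤ) < 2 ^ j := by positivity
    by_cases h : a + 2 ^ j ≤ 0
    · exact ⟨a, le_rfl, by omega, fun z h1 h2 => by omega⟩
    · refine ⟨max a (height j), le_max_left _ _, by omega, fun z h1 h2 => ?_⟩
      rw [add_zero, getD_cantorSeq_of_gt (by omega)]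
      norm_num
  | succ i ih =>
    rw [← add_assoc]
    have hp : (2 : ℤ) ^ j ≤ 2 ^ (j + i) := pow_le_pow_right₀ (by norm_num) (by omega)
    have hsplit : ∀ z : ℕ, (cantorSeq (j + i + 1)).getD z 0 = 2 →
        (z ≤ height (j + i) ∧ (cantorSeq (j + i)).getD z 0 = 2) ∨
        (∃ z', z = height (j + i) + 2 ^ (j + i) + z' ∧ (cantorSeq (j + i)).getD z' 0 = 2) := by
      intro z hz
      rcases Nat.lt_or_ge (height (j + i)) z with h1 | h1
      · rcases Nat.lt_or_ge z (height (j + i) + 2 ^ (j + i)) with h2 | h2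
        · rw [getD_cantorSeq_succ_mid h1 h2] at hz; norm_num at hz
        · obtain ⟨k, rfl⟩ := Nat.exists_eq_add_of_le h2
          rw [getD_cantorSeq_succ_add] at hz
          exact Or.inr ⟨k, rfl, hz⟩
      · rw [getD_cantorSeq_succ_of_le h1] at hz
        exact Or.inl ⟨h1, hz⟩
    by_cases ha : (height (j + i) : ℤ) ≤ a
    · obtain ⟨y, h1, h2, h3⟩ := ih (a - (height (j + i) + 2 ^ (j + i)))
      refine ⟨y + (height (j + i) + 2 ^ (j + i)), by omega, by omega, fun z hz1 hz2 hz => ?_⟩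
      rcases hsplit z hz with ⟨h4, h5⟩ | ⟨z', rfl, h5⟩
      · omega
      · push_cast at hz1 hz2
        exact h3 z' (by omega) (by omega) h5
    · obtain ⟨y, h1, h2, h3⟩ := ih a
      by_cases hy : y + 2 ^ j ≤ height (j + i) + 2 ^ (j + i)
      · refine ⟨y, h1, h2, fun z hz1 hz2 hz => ?_⟩
        rcases hsplit z hz with ⟨h4, h5⟩ | ⟨z', rfl, h5⟩
        · exact h3 z hz1 hz2 h5
        · push_cast at hz1 hz2
          omega
      -- The stretch found for the left copy runs into the right copy, so y exceeds the height of
      -- the left copy, and the start of the middle gap lies between a and y.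
      · refine ⟨height (j + i), by omega, by omega, fun z hz1 hz2 hz => ?_⟩
        rcases hsplit z hz with ⟨h4, h5⟩ | ⟨z', rfl, h5⟩
        · omega
        · push_cast at hz1 hz2
          omega

/-- Every interval of levels of length `height j + 2 * 2 ^ j` contains an interval of length
`2 ^ j` in whose interior no vertex branches. -/
theorem exists_free_interval {i j a b : ℕ} (hb : b ≤ height i)
    (hab : a + height j + 2 * 2 ^ j ≤ b) : ∃ y, a ≤ y ∧ y + 2 ^ j ≤ b ∧
    ∀ z, y < z → z < y + 2 ^ j → (cantorDegrees i).getD z 0 ≤ 1 := by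
  have hji : j ≤ i := by
    by_contra h
    have := height_mono (Nat.le_of_lt (not_le.1 h))
    have := Nat.two_pow_pos j
    omega
  obtain ⟨n, rfl⟩ := Nat.exists_eq_add_of_le hji
  obtain ⟨y, h1, h2, h3⟩ := exists_free j n a
  lift y to ℕ using by omega
  have hcast : ((2 ^ j : ℕ) : ℤ) = 2 ^ j := by push_cast; rfl
  refine ⟨y, by omega, by omega, fun z hz1 hz2 => ?_⟩
  have h4 := h3 z (by omega) (by omega)
  have h5 := getD_cantorSeq_eq_one_or_two (i := j + n) (j := z) (by omega)
  have h6 := getD_cantorDegrees_le (j + n) z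
  omega

/-! ### Expectations and the Markov property -/

section Markov

variable {α β : Type*} {Ω : Type}

theorem expect_bind (μ : PMF α) (κ : α → PMF β) (g : β → ℝ≥0∞) :
    expect (μ.bind κ) g = expect μ fun a => expect (κ a) g := by
  simp only [expect, PMF.bind_apply, ← ENNReal.tsum_mul_right, ← ENNReal.tsum_mul_left]
  rw [ENNReal.tsum_comm]
  simp only [mul_assoc]

theorem expect_pure (a : α) (g : α → ℝ≥0∞) : expect (PMF.pure a) g = g a := by
  rw [expect, tsum_eq_single a]
  · simp
  · intro b hb; simp [PMF.pure_apply, hb]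

theorem expect_map (μ : PMF α) (φ : α → β) (g : β → ℝ≥0∞) :
    expect (μ.map φ) g = expect μ fun a => g (φ a) := by
  rw [← PMF.bind_pure_comp, expect_bind]
  simp [expect_pure]

theorem expect_mono (μ : PMF α) {g g' : α → ℝ≥0∞} (h : ∀ a ∈ μ.support, g a ≤ g' a) :
    expect μ g ≤ expect μ g' := by
  refine ENNReal.tsum_le_tsum fun a => ?_
  by_cases ha : a ∈ μ.support
  · exact mul_le_mul_right (h a ha) _
  · simp [(PMF.apply_eq_zero_iff μ a).2 ha]

theorem expect_add (μ : PMF α) (g g' : α → ℝ≥0∞) :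
    expect μ (fun a => g a + g' a) = expect μ g + expect μ g' := by
  simp only [expect, mul_add, ENNReal.tsum_add]

theorem expect_const_mul (μ : PMF α) (c : ℝ≥0∞) (g : α → ℝ≥0∞) :
    expect μ (fun a => c * g a) = c * expect μ g := by
  simp only [expect, mul_left_comm _ c, ENNReal.tsum_mul_left]

theorem expect_const (μ : PMF α) (c : ℝ≥0∞) : expect μ (fun _ => c) = c := by
  simp [expect, ENNReal.tsum_mul_right, PMF.tsum_coe]

theorem chainLaw_add (init : PMF Ω) (step : Ω → PMF Ω) (s n : ℕ) :
    chainLaw init step (s + n) =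
      (chainLaw init step s).bind fun x => chainLaw (PMF.pure x) step n := by
  induction n with
  | zero => simp [chainLaw]
  | succ n ih => rw [← add_assoc, chainLaw, ih, PMF.bind_bind]; rfl

theorem chainLaw_pure_succ (step : Ω → PMF Ω) (x : Ω) (n : ℕ) :
    chainLaw (PMF.pure x) step (n + 1) =
      (step x).bind fun y => chainLaw (PMF.pure y) step n := by
  rw [add_comm, chainLaw_add]
  simp [chainLaw]

/-- The expectation of `g (X_s, X_t)` for `s ≤ t`. -/
def pairExpect (init : PMF Ω) (step : Ω → PMF Ω) (g : Ω → Ω → ℝ≥0∞) (s t : ℕ) : ℝ≥0∞ :=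
  expect (chainLaw init step s) fun x => expect (chainLaw (PMF.pure x) step (t - s)) (g x)

theorem expect_splitLaw (init : PMF Ω) (step : Ω → PMF Ω) (s t : ℕ) (g : Ω × Ω → ℝ≥0∞) :
    expect (splitLaw init step s t) g = expect (chainLaw init step s) fun x =>
      expect (chainLaw (PMF.pure x) step (t - s)) fun y =>
        expect (chainLaw (PMF.pure x) step (t - s)) fun z => g (y, z) := by
  simp only [splitLaw, expect_bind, expect_map]

theorem expect_stepLaw (init : PMF Ω) (step : Ω → PMF Ω) (t : ℕ) (g : Ω × Ω → ℝ≥0∞) :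
    expect (stepLaw init step t) g = pairExpect init step (fun x y => g (x, y)) t (t + 1) := by
  simp only [stepLaw, pairExpect, expect_bind, expect_map, Nat.add_sub_cancel_left,
    chainLaw, PMF.pure_bind]

/-! ### Markov convexity from a four-point inequality -/

/-- The four-point inequality which, with an exponent `q`, implies Markov `q`-convexity. -/
def IsForkConvex (X : Type*) [EDist X] (q : ℝ) (B : ℝ≥0∞) : Prop :=
  ∀ x y z w : X, (2 : ℝ≥0∞) ^ (1 - q) * (edist x z ^ q + edist x w ^ q) + B * edist z w ^ q ≤
    edist y z ^ q + edist y w ^ q + 2 * edist x y ^ q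

/-- The four-point inequality is averaged over x = X_r, y = X_s and two conditionally independent
continuations z, w up to time t. By the Markov property each of (x, z) and (x, w) has the law of
(X_r, X_t). -/
theorem fork_expect {X : Type*} [EDist X] {q : ℝ} {B : ℝ≥0∞} (hX : IsForkConvex X q B)
    (init : PMF Ω) (step : Ω → PMF Ω) (f : Ω → X) {r s t : ℕ} (hrs : r ≤ s) (hst : s ≤ t) :
    (2 : ℝ≥0∞) ^ (1 - q) * (2 * pairExpect init step (fun x y => edist (f x) (f y) ^ q) r t) +
      B * expect (splitLaw init step s t) (fun z => edist (f z.1) (f z.2) ^ q) ≤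
    2 * pairExpect init step (fun x y => edist (f x) (f y) ^ q) s t +
      2 * pairExpect init step (fun x y => edist (f x) (f y) ^ q) r s := by
  have key := expect_mono (chainLaw init step r) fun x _ =>
    expect_mono (chainLaw (PMF.pure x) step (s - r)) fun y _ =>
      expect_mono (chainLaw (PMF.pure y) step (t - s)) fun z _ =>
        expect_mono (chainLaw (PMF.pure y) step (t - s)) fun w _ => hX (f x) (f y) (f z) (f w)
  simp only [expect_add, expect_const_mul, expect_const] at key
  have h1 : ∀ g : Ω → ℝ≥0∞, (expect (chainLaw init step r) fun x =>
      expect (chainLaw (PMF.pure x) step (s - r)) g) = expect (chainLaw init step s) g := by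
    intro g
    rw [← expect_bind, ← chainLaw_add, Nat.add_sub_cancel' hrs]
  have h2 : ∀ g : Ω → Ω → ℝ≥0∞, (expect (chainLaw init step r) fun x =>
      expect (chainLaw (PMF.pure x) step (s - r)) fun y =>
        expect (chainLaw (PMF.pure y) step (t - s)) (g x)) = pairExpect init step g r t := by
    intro g
    simp only [← expect_bind, pairExpect, ← chainLaw_add]
    rw [show s - r + (t - s) = t - r by omega]
  rw [expect_splitLaw]
  simp only [h1 fun y => expect (chainLaw (PMF.pure y) step (t - s)) fun z => edist (f y) (f z) ^ q,
    h1 fun y => expect (chainLaw (PMF.pure y) step (t - s)) fun z =>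
      expect (chainLaw (PMF.pure y) step (t - s)) fun w => edist (f z) (f w) ^ q,
    h2 fun x z => edist (f x) (f z) ^ q] at key
  calc _ = _ := by rw [two_mul]
    _ ≤ _ := key
    _ = _ := by
      simp only [two_mul, pairExpect]

/-- Terms with t ≤ a vanish because truncated subtraction makes both times 0; the others are
reindexed by t - a. -/
theorem sum_shift_le {D : ℕ → ℕ → ℝ≥0∞} (hD : D 0 0 = 0) (n a : ℕ) :
    ∑ t ∈ Finset.Icc 1 n, D (t - 2 * a) (t - a) ≤ ∑ t ∈ Finset.Icc 1 n, D (t - a) t := by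
  have h1 : ∑ t ∈ Finset.Icc 1 n, D (t - 2 * a) (t - a) =
      ∑ t ∈ (Finset.Icc 1 n).filter (a < ·), D (t - 2 * a) (t - a) := by
    refine (Finset.sum_filter_of_ne fun t _ h => ?_).symm
    by_contra hlt
    rw [show t - 2 * a = 0 by omega, show t - a = 0 by omega] at h
    exact h hD
  have h2 : ∑ t ∈ (Finset.Icc 1 n).filter (a < ·), D (t - 2 * a) (t - a) =
      ∑ t ∈ ((Finset.Icc 1 n).filter (a < ·)).image (· - a), D (t - a) t := by
    rw [Finset.sum_image]
    · refine Finset.sum_congr rfl fun t _ => ?_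
      rw [show t - a - a = t - 2 * a by omega]
    · intro t ht t' ht' h
      simp only [Finset.coe_filter, Finset.mem_Icc, Set.mem_ofPred_eq] at ht ht'
      simp only at h
      omega
  rw [h1, h2]
  refine Finset.sum_le_sum_of_subset fun t ht => ?_
  obtain ⟨t', h, rfl⟩ := Finset.mem_image.1 ht
  simp only [Finset.mem_filter, Finset.mem_Icc] at h ⊢
  omega

/-- With S k the sum of E d(X_{t-2^k}, X_t)^q, the averaged fork inequality says that S k / 2^(kq)
drops by at least c/4 times the k-th term of the left side as k grows by one. Summing telescopes to
S 0, the right side of Markov convexity. -/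
theorem IsForkConvex.isMarkovConvexWith {X : Type*} [PseudoEMetricSpace X] {q : ℝ} (hq : 0 < q)
    {c : ℝ≥0} (hc : 0 < c) (hX : IsForkConvex X q (c : ℝ≥0∞)) :
    IsMarkovConvexWith X q ((4 / c) ^ (1 / q)) := by
  intro Ω init step f m
  set D : ℕ → ℕ → ℝ≥0∞ := pairExpect init step (fun x y => edist (f x) (f y) ^ q) with hD
  set S : ℕ → ℝ≥0∞ := fun k => ∑ t ∈ Finset.Icc 1 (2 ^ m), D (t - 2 ^ k) t with hS
  set E : ℕ → ℝ≥0∞ := fun k => ∑ t ∈ Finset.Icc 1 (2 ^ m),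
    expect (splitLaw init step (t - 2 ^ k) t) (fun z => edist (f z.1) (f z.2) ^ q) with hE
  have hD0 : D 0 0 = 0 := by
    simp [hD, pairExpect, chainLaw, expect_pure, hq, expect_const]
  have two_ne : (2 : ℝ≥0∞) ≠ 0 := by norm_num
  have two_top : (2 : ℝ≥0∞) ≠ ⊤ := by norm_num
  have step1 : ∀ k, (2 : ℝ≥0∞) ^ (1 - q) * (2 * S (k + 1)) + c * E k ≤ 4 * S k := by
    intro k
    have h1 := Finset.sum_le_sum fun t (_ : t ∈ Finset.Icc 1 (2 ^ m)) =>
      fork_expect hX init step f (r := t - 2 ^ (k + 1)) (s := t - 2 ^ k) (t := t)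
        (by have := Nat.pow_le_pow_right (n := 2) (by norm_num) (Nat.le_succ k); omega)
        (Nat.sub_le _ _)
    simp only [Finset.sum_add_distrib, ← Finset.mul_sum] at h1
    -- The increments from t - 2^(k+1) to t - 2^k also sum to at most S k, whence the factor 4 = 2 +
    -- 2.
    have h2 := sum_shift_le hD0 (2 ^ m) (2 ^ k)
    rw [← pow_succ'] at h2
    refine h1.trans ((add_le_add_right (mul_le_mul_right h2 _) _).trans_eq ?_)
    rw [← two_mul, ← mul_assoc]
    norm_num
    rfl
  have step2 : ∀ k, S (k + 1) / (2 : ℝ≥0∞) ^ (((k + 1 : ℕ) : ℝ) * q) +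
      (c / 4) * (E k / (2 : ℝ≥0∞) ^ ((k : ℝ) * q)) ≤ S k / (2 : ℝ≥0∞) ^ ((k : ℝ) * q) := by
    intro k
    have h1 := ENNReal.div_le_div_right (step1 k) (4 * (2 : ℝ≥0∞) ^ ((k : ℝ) * q))
    have h4 : (4 : ℝ≥0∞) = 2 ^ (2 : ℝ) := by norm_num
    have h40 : (4 : ℝ≥0∞) ≠ 0 := by norm_num
    have h4t : (4 : ℝ≥0∞) ≠ ⊤ := by norm_num
    have hk0 : (2 : ℝ≥0∞) ^ ((k : ℝ) * q) ≠ 0 := by simp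
    have hkt : (2 : ℝ≥0∞) ^ ((k : ℝ) * q) ≠ ⊤ := by simp
    rw [ENNReal.mul_div_mul_left _ _ h40 h4t, ENNReal.add_div] at h1
    refine le_trans (le_of_eq ?_) h1
    congr 1
    · rw [h4, ← ENNReal.rpow_add _ _ two_ne two_top, ← mul_assoc]
      have : (2 : ℝ≥0∞) ^ (1 - q) * 2 = 2 ^ (2 - q) := by
        nth_rw 2 [← ENNReal.rpow_one 2]
        rw [← ENNReal.rpow_add _ _ two_ne two_top]
        congr 1; ring
      rw [this, div_eq_mul_inv, div_eq_mul_inv, ← ENNReal.rpow_neg, ← ENNReal.rpow_neg,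
        mul_comm ((2 : ℝ≥0∞) ^ (2 - q)), mul_assoc, ← ENNReal.rpow_add _ _ two_ne two_top]
      congr 2
      push_cast; ring
    · rw [div_eq_mul_inv, div_eq_mul_inv, div_eq_mul_inv,
        ENNReal.mul_inv (Or.inl h40) (Or.inl h4t)]
      ring
  have step3 : ∀ n, S n / (2 : ℝ≥0∞) ^ ((n : ℝ) * q) +
      (c / 4) * ∑ k ∈ Finset.range n, E k / (2 : ℝ≥0∞) ^ ((k : ℝ) * q) ≤ S 0 := by
    intro n
    induction n with
    | zero => simp
    | succ n ih =>
      refine le_trans ?_ ih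
      rw [Finset.sum_range_succ, mul_add, add_comm ((c / 4 : ℝ≥0∞) * _), ← add_assoc]
      exact add_le_add_left (step2 n) _
  have hfin := (le_add_self).trans (step3 (m + 1))
  have hS0 : S 0 = ∑ t ∈ Finset.Icc 1 (2 ^ m),
      expect (stepLaw init step (t - 1)) (fun z => edist (f z.2) (f z.1) ^ q) := by
    refine Finset.sum_congr rfl fun t ht => ?_
    rw [Finset.mem_Icc] at ht
    rw [expect_stepLaw, pow_zero, Nat.sub_add_cancel ht.1]
    simp only [hD, edist_comm]
  have hc' : (c : ℝ≥0∞) ≠ 0 := by simpa using hc.ne'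
  have hC : (((4 / c) ^ (1 / q) : ℝ≥0) : ℝ≥0∞) ^ q = 4 / c := by
    rw [← ENNReal.coe_rpow_of_nonneg _ hq.le, ← NNReal.rpow_mul, one_div,
      inv_mul_cancel₀ hq.ne', NNReal.rpow_one, ENNReal.coe_div hc.ne']
    rfl
  rw [hC, ← hS0]
  have hcc : (4 / c : ℝ≥0∞) * (c / 4) = 1 := by
    rw [← mul_div_assoc, ENNReal.div_mul_cancel hc' ENNReal.coe_ne_top]
    exact ENNReal.div_self (by norm_num) (by norm_num)
  calc _ = ∑ k ∈ Finset.range (m + 1), E k / (2 : ℝ≥0∞) ^ ((k : ℝ) * q) := by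
        refine Finset.sum_congr rfl fun k _ => ?_
        simp only [hE, div_eq_mul_inv, Finset.sum_mul]
    _ = (4 / c) * ((c / 4) * ∑ k ∈ Finset.range (m + 1), E k / (2 : ℝ≥0∞) ^ ((k : ℝ) * q)) := by
        rw [← mul_assoc, hcc, one_mul]
    _ ≤ _ := mul_le_mul_right hfin _

end Markov

/-! ### Markov convexity and distortion -/

/-- Two distinct points make both Lipschitz constants nonzero, so a finite product forces both to be
finite; on one point both suprema are empty. -/
theorem edist_le_of_mapDistortion {X Y : Type*} [MetricSpace X] [MetricSpace Y] [Nontrivial X]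
    {f : X → Y} (hf : Function.Injective f) (h : mapDistortion f ≠ ⊤) :
    ∃ A B : ℝ≥0, (A : ℝ≥0∞) * B = mapDistortion f ∧ 0 < B ∧
      (∀ x y, edist (f x) (f y) ≤ A * edist x y) ∧ (∀ x y, edist x y ≤ B * edist (f x) (f y)) := by
  set A := ⨆ (x : X) (y : X) (_ : x ≠ y), edist (f x) (f y) / edist x y with hA
  set B := ⨆ (x : X) (y : X) (_ : x ≠ y), edist x y / edist (f x) (f y) with hB
  have hAle : ∀ x y, x ≠ y → edist (f x) (f y) / edist x y ≤ A := fun x y hxy =>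
    le_iSup_of_le x (le_iSup_of_le y (le_iSup_of_le hxy le_rfl))
  have hBle : ∀ x y, x ≠ y → edist x y / edist (f x) (f y) ≤ B := fun x y hxy =>
    le_iSup_of_le x (le_iSup_of_le y (le_iSup_of_le hxy le_rfl))
  have hX : ∀ x y : X, x ≠ y → edist x y ≠ 0 := fun x y h => by simpa using h
  have hY : ∀ x y : X, x ≠ y → edist (f x) (f y) ≠ 0 := fun x y h => by simpa using hf.ne h
  have hmul : A * B = mapDistortion f := rfl
  obtain ⟨x, y, hxy⟩ := exists_pair_ne X
  have hA0 : A ≠ 0 := fun h0 => by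
    have h1 := hAle x y hxy
    rw [h0, nonpos_iff_eq_zero, ENNReal.div_eq_zero_iff] at h1
    exact h1.elim (hY x y hxy) (edist_ne_top _ _)
  have hB0 : B ≠ 0 := fun h0 => by
    have h1 := hBle x y hxy
    rw [h0, nonpos_iff_eq_zero, ENNReal.div_eq_zero_iff] at h1
    exact h1.elim (hX x y hxy) (edist_ne_top _ _)
  have hAt : A ≠ ⊤ := fun ht => h (by rw [← hmul, ht, ENNReal.top_mul hB0])
  have hBt : B ≠ ⊤ := fun ht => h (by rw [← hmul, ht, ENNReal.mul_top hA0])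
  refine ⟨A.toNNReal, B.toNNReal, ?_, ENNReal.toNNReal_pos hB0 hBt, fun x y => ?_, fun x y => ?_⟩
  · rw [ENNReal.coe_toNNReal hAt, ENNReal.coe_toNNReal hBt, hmul]
  · rw [ENNReal.coe_toNNReal hAt]
    rcases eq_or_ne x y with rfl | hne
    · simp
    · exact (ENNReal.div_le_iff (hX x y hne) (edist_ne_top _ _)).1 (hAle x y hne)
  · rw [ENNReal.coe_toNNReal hBt]
    rcases eq_or_ne x y with rfl | hne
    · simp
    · exact (ENNReal.div_le_iff (hY x y hne) (edist_ne_top _ _)).1 (hBle x y hne)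

theorem IsMarkovConvexWith.of_biLipschitz {X Y : Type*} [EDist X] [EDist Y] {q : ℝ} (hq : 0 < q)
    {C A B : ℝ≥0} (hY : IsMarkovConvexWith Y q C) (F : X → Y)
    (hA : ∀ x y, edist (F x) (F y) ≤ A * edist x y)
    (hB : ∀ x y, edist x y ≤ B * edist (F x) (F y)) : IsMarkovConvexWith X q (A * B * C) := by
  intro Ω init step f m
  have h := hY Ω init step (fun ω => F (f ω)) m
  have hA' : ∀ x y, edist (F x) (F y) ^ q ≤ (A : ℝ≥0∞) ^ q * edist x y ^ q := fun x y => by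
    rw [← ENNReal.mul_rpow_of_nonneg _ _ hq.le]
    exact ENNReal.rpow_le_rpow (hA x y) hq.le
  have hB' : ∀ x y, edist x y ^ q ≤ (B : ℝ≥0∞) ^ q * edist (F x) (F y) ^ q := fun x y => by
    rw [← ENNReal.mul_rpow_of_nonneg _ _ hq.le]
    exact ENNReal.rpow_le_rpow (hB x y) hq.le
  calc _ ≤ (B : ℝ≥0∞) ^ q * ∑ k ∈ Finset.range (m + 1), ∑ t ∈ Finset.Icc 1 (2 ^ m),
        expect (splitLaw init step (t - 2 ^ k) t)
          (fun z => edist (F (f z.1)) (F (f z.2)) ^ q) / (2 : ℝ≥0∞) ^ ((k : ℝ) * q) := by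
        simp only [Finset.mul_sum]
        refine Finset.sum_le_sum fun k _ => Finset.sum_le_sum fun t _ => ?_
        rw [← mul_div_assoc, ← expect_const_mul]
        exact ENNReal.div_le_div_right (expect_mono _ fun z _ => hB' _ _) _
    _ ≤ (B : ℝ≥0∞) ^ q * ((C : ℝ≥0∞) ^ q * ∑ t ∈ Finset.Icc 1 (2 ^ m),
          expect (stepLaw init step (t - 1)) (fun z => edist (F (f z.2)) (F (f z.1)) ^ q)) :=
        mul_le_mul_right h _
    _ ≤ (B : ℝ≥0∞) ^ q * ((C : ℝ≥0∞) ^ q * ((A : ℝ≥0∞) ^ q * ∑ t ∈ Finset.Icc 1 (2 ^ m),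
          expect (stepLaw init step (t - 1)) (fun z => edist (f z.2) (f z.1) ^ q))) := by
        gcongr
        simp only [Finset.mul_sum]
        refine Finset.sum_le_sum fun t _ => ?_
        rw [← expect_const_mul]
        exact expect_mono _ fun z _ => hA' _ _
    _ = _ := by
        push_cast
        rw [ENNReal.mul_rpow_of_nonneg _ _ hq.le, ENNReal.mul_rpow_of_nonneg _ _ hq.le]
        ring

theorem markovConvexity_le_distortion {X Y : Type*} [MetricSpace X] [MetricSpace Y] {q : ℝ}
    (hq : 0 < q) {C : ℝ≥0} (hC : 0 < C) (hY : IsMarkovConvexWith Y q C) :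
    markovConvexity q X ≤ C * distortion X Y := by
  rcases subsingleton_or_nontrivial X with hX | hX
  · have : IsMarkovConvexWith X q 0 := by
      intro Ω init step f m
      have : ∀ x y : X, edist x y ^ q = 0 := fun x y => by
        rw [Subsingleton.elim x y, edist_self, ENNReal.zero_rpow_of_pos hq]
      simp [this, expect]
    exact (iInf₂_le 0 this).trans (by simp)
  · have hC' : (C : ℝ≥0∞) ≠ 0 := by simpa using hC.ne'
    rw [distortion]
    simp only [ENNReal.mul_iInf_of_ne hC' ENNReal.coe_ne_top]
    refine le_iInf₂ fun f hf => ?_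
    by_cases ht : mapDistortion f = ⊤
    · simp [ht, ENNReal.mul_top hC']
    · obtain ⟨A, B, hAB, -, hA, hB⟩ := edist_le_of_mapDistortion hf ht
      refine (iInf₂_le _ (hY.of_biLipschitz hq f hA hB)).trans_eq ?_
      rw [← hAB]; push_cast; ring

/-! ### Uniform convexity of `L_p` -/

open MeasureTheory

theorem rpow_mean_le {a b r : ℝ} (ha : 0 ≤ a) (hb : 0 ≤ b) (hr : 1 ≤ r) :
    ((a + b) / 2) ^ r ≤ (a ^ r + b ^ r) / 2 := by
  have h := (convexOn_rpow hr).2 (Set.mem_Ici.2 ha) (Set.mem_Ici.2 hb)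
    (by norm_num : (0 : ℝ) ≤ 1 / 2) (by norm_num : (0 : ℝ) ≤ 1 / 2) (by norm_num)
  simp only [smul_eq_mul] at h
  calc _ = (1 / 2 * a + 1 / 2 * b) ^ r := by ring_nf
    _ ≤ _ := h
    _ = _ := by ring

theorem sq_rpow_half {x : ℝ} (hx : 0 ≤ x) (p : ℝ) : (x ^ 2) ^ (p / 2) = x ^ p := by
  rw [← Real.rpow_natCast, ← Real.rpow_mul hx]
  congr 1; push_cast; ring

/-- A two-point convexity inequality for exponents at least two. -/
theorem rpow_add_rpow_le_mean {p : ℝ} (hp : 2 ≤ p) (a b : ℝ) :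
    |a| ^ p + |b| ^ p ≤ (|a + b| ^ p + |a - b| ^ p) / 2 := by
  have hr : 1 ≤ p / 2 := by linarith
  simp only [← sq_rpow_half (abs_nonneg _) p, sq_abs]
  -- Superadditivity of the power p/2 ≥ 1, then its convexity, as a² + b² is the mean of (a + b)²
  -- and (a - b)².
  refine (Real.add_rpow_le_rpow_add (sq_nonneg a) (sq_nonneg b) hr).trans ?_
  refine le_trans (le_of_eq ?_) (rpow_mean_le (sq_nonneg (a + b)) (sq_nonneg (a - b)) hr)
  congr 1; ring

/-- On [0, 2] the function x^p - k·x² is convex: x^(p-2) ≥ 2^(p-2) ≥ 1/2 and 2k = p(p-1)/2. Midpoint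
convexity at 1 + t and 1 - t is the claim. -/
theorem one_add_mul_sq_le_mean {p : ℝ} (hp : 1 < p) (hp' : p ≤ 2) {t : ℝ} (ht : 0 ≤ t)
    (ht' : t ≤ 1) :
    1 + p * (p - 1) / 4 * t ^ 2 ≤ ((1 + t) ^ p + (1 - t) ^ p) / 2 := by
  set k := p * (p - 1) / 4 with hk
  have hconv : ConvexOn ℝ (Set.Icc (0 : ℝ) 2) fun x => x ^ p - k * x ^ 2 := by
    refine convexOn_of_hasDerivWithinAt2_nonneg (convex_Icc 0 2)
      (f' := fun x => p * x ^ (p - 1) - k * (2 * x))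
      (f'' := fun x => p * ((p - 1) * x ^ (p - 1 - 1)) - k * 2) ?_ ?_ ?_ ?_
    · refine ContinuousOn.sub ?_ (by fun_prop)
      exact (Real.continuous_rpow_const (by linarith)).continuousOn
    · intro x hx
      rw [interior_Icc] at hx
      refine HasDerivAt.hasDerivWithinAt ?_
      refine (Real.hasDerivAt_rpow_const (Or.inl hx.1.ne')).sub ?_
      simpa using (hasDerivAt_pow 2 x).const_mul k
    · intro x hx
      rw [interior_Icc] at hx
      refine HasDerivAt.hasDerivWithinAt ?_
      refine ((Real.hasDerivAt_rpow_const (Or.inl hx.1.ne')).const_mul p).sub ?_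
      simpa using ((hasDerivAt_id x).const_mul 2).const_mul k
    · intro x hx
      rw [interior_Icc] at hx
      have h1 : (1 / 2 : ℝ) ≤ x ^ (p - 1 - 1) := by
        calc (1 / 2 : ℝ) = 2 ^ (-1 : ℝ) := by rw [Real.rpow_neg_one]; norm_num
          _ ≤ 2 ^ (p - 1 - 1) := Real.rpow_le_rpow_of_exponent_le (by norm_num) (by linarith)
          _ ≤ x ^ (p - 1 - 1) :=
            Real.rpow_le_rpow_of_nonpos hx.1 hx.2.le (by linarith)
      have h2 : 0 < p * (p - 1) := mul_pos (by linarith) (by linarith)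
      rw [hk]
      nlinarith [mul_le_mul_of_nonneg_left h1 h2.le]
  have h := hconv.2 (x := 1 + t) (y := 1 - t) ⟨by linarith, by linarith⟩
    ⟨by linarith, by linarith⟩ (by norm_num : (0 : ℝ) ≤ 1 / 2) (by norm_num : (0 : ℝ) ≤ 1 / 2)
    (by norm_num)
  simp only [smul_eq_mul] at h
  rw [show 1 / 2 * (1 + t) + 1 / 2 * (1 - t) = 1 by ring, Real.one_rpow] at h
  nlinarith

/-- A two-point convexity inequality for exponents between one and two. -/
theorem rpow_half_le_mean {p : ℝ} (hp : 1 < p) (hp' : p ≤ 2) (a b : ℝ) :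
    (a ^ 2 + (p - 1) / 2 * b ^ 2) ^ (p / 2) ≤ (|a + b| ^ p + |a - b| ^ p) / 2 := by
  have key : ∀ a b : ℝ, 0 ≤ b → b ≤ a →
      (a ^ 2 + (p - 1) / 2 * b ^ 2) ^ (p / 2) ≤ ((a + b) ^ p + (a - b) ^ p) / 2 := by
    intro a b hb hba
    rcases hb.eq_or_lt with rfl | hb'
    · simp [sq_rpow_half hba]
    have ha : 0 < a := hb'.trans_le hba
    set t := b / a with ht
    have hbt : b = a * t := by rw [ht]; field_simp
    have ht0 : 0 ≤ t := by positivity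
    have ht1 : t ≤ 1 := (div_le_one ha).2 hba
    have h1 := one_add_mul_sq_le_mean hp hp' ht0 ht1
    -- Bernoulli's inequality for the exponent p/2 ≤ 1.
    have h2 : (1 + (p - 1) / 2 * t ^ 2) ^ (p / 2) ≤ 1 + p / 2 * ((p - 1) / 2 * t ^ 2) :=
      rpow_one_add_le_one_add_mul_self
        (le_trans (by norm_num) (mul_nonneg (by linarith) (sq_nonneg t)))
        (by linarith) (by linarith)
    have h3 : 0 ≤ 1 + (p - 1) / 2 * t ^ 2 := by
      have := mul_nonneg (by linarith : 0 ≤ (p - 1) / 2) (sq_nonneg t); linarith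
    rw [hbt, show a ^ 2 + (p - 1) / 2 * (a * t) ^ 2 = a ^ 2 * (1 + (p - 1) / 2 * t ^ 2) by ring,
      show a + a * t = a * (1 + t) by ring, show a - a * t = a * (1 - t) by ring,
      Real.mul_rpow (sq_nonneg a) h3, Real.mul_rpow ha.le (by linarith),
      Real.mul_rpow ha.le (by linarith), sq_rpow_half ha.le, ← mul_add, mul_div_assoc]
    refine mul_le_mul_of_nonneg_left ?_ (by positivity)
    linarith
  have sym : ∀ a b : ℝ, |a + b| ^ p + |a - b| ^ p = (|a| + |b|) ^ p + |(|a| - |b|)| ^ p := by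
    intro a b
    rcases le_total 0 a with ha | ha <;> rcases le_total 0 b with hb | hb
    · rw [abs_of_nonneg ha, abs_of_nonneg hb, abs_of_nonneg (add_nonneg ha hb)]
    · rw [abs_of_nonneg ha, abs_of_nonpos hb, sub_neg_eq_add, add_comm, ← sub_eq_add_neg,
        abs_of_nonneg (by linarith : 0 ≤ a - b)]
    · rw [abs_of_nonpos ha, abs_of_nonneg hb, abs_of_nonpos (by linarith : a - b ≤ 0), add_comm,
        ← abs_neg (a + b)]
      ring_nf
    · rw [abs_of_nonpos ha, abs_of_nonpos hb, abs_of_nonpos (by linarith : a + b ≤ 0),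
        ← abs_neg (a - b)]
      ring_nf
  rw [sym]
  rcases le_total |b| |a| with h | h
  · rw [abs_of_nonneg (sub_nonneg.2 h)]
    simpa only [sq_abs] using key |a| |b| (abs_nonneg b) h
  -- Exchanging a and b only increases the left side, since (p - 1)/2 ≤ 1.
  · have h1 := key |b| |a| (abs_nonneg a) h
    rw [abs_sub_comm, abs_of_nonneg (sub_nonneg.2 h), add_comm |a|]
    refine le_trans (Real.rpow_le_rpow ?_ ?_ (by linarith)) h1
    · have := mul_nonneg (by linarith : 0 ≤ (p - 1) / 2) (sq_nonneg b)
      positivity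
    · have h2 : |a| ^ 2 ≤ |b| ^ 2 := by gcongr
      simp only [sq_abs] at h2 ⊢
      nlinarith

/-- A case of Hölder's inequality. -/
theorem rpow_mul_add_rpow_mul_le {p : ℝ} (hp : 0 < p) (hp' : p < 2) {x y X Y : ℝ} (hx : 0 ≤ x)
    (hy : 0 ≤ y) (hX : 0 ≤ X) (hY : 0 ≤ Y) :
    x ^ p * X ^ (2 - p) + y ^ p * Y ^ (2 - p) ≤
      (x ^ 2 + y ^ 2) ^ (p / 2) * (X ^ 2 + Y ^ 2) ^ ((2 - p) / 2) := by
  have hpos : 0 < 2 - p := by linarith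
  have hconj : (2 / p).HolderConjugate (2 / (2 - p)) := by
    rw [Real.holderConjugate_iff]
    refine ⟨by rw [lt_div_iff₀ hp]; linarith, ?_⟩
    field_simp
    ring
  have h := Real.inner_le_Lp_mul_Lq_of_nonneg Finset.univ (f := ![x ^ p, y ^ p])
    (g := ![X ^ (2 - p), Y ^ (2 - p)]) hconj
    (fun i _ => by fin_cases i <;> simp <;> positivity)
    (fun i _ => by fin_cases i <;> simp <;> positivity)
  have e1 : ∀ z : ℝ, 0 ≤ z → (z ^ p) ^ (2 / p) = z ^ 2 := fun z hz => by
    rw [← Real.rpow_mul hz, mul_div_cancel₀ _ hp.ne']; norm_num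
  have e2 : ∀ z : ℝ, 0 ≤ z → (z ^ (2 - p)) ^ (2 / (2 - p)) = z ^ 2 := fun z hz => by
    rw [← Real.rpow_mul hz, mul_div_cancel₀ _ hpos.ne']; norm_num
  simpa [Fin.sum_univ_two, e1, e2, hx, hy, hX, hY] using h

/-- The uniform convexity inequality with exponent `q` and constant `c`. -/
def IsUniformlyConvexWith (E : Type*) [NormedAddCommGroup E] (q c : ℝ) : Prop :=
  ∀ x y : E, ‖x‖ ^ q + c * ‖y‖ ^ q ≤ (‖x + y‖ ^ q + ‖x - y‖ ^ q) / 2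

section Lp

variable {α : Type*} [MeasurableSpace α] {μ : Measure α} {p : ℝ}

theorem Lp_integrable_rpow (hp : 0 < p) (f : Lp ℝ (ENNReal.ofReal p) μ) :
    Integrable (fun a => |f a| ^ p) μ := by
  have := (Lp.memLp f).integrable_norm_rpow (by simpa using hp) ENNReal.ofReal_ne_top
  simpa [ENNReal.toReal_ofReal hp.le] using this

theorem Lp_norm_rpow (hp : 0 < p) (f : Lp ℝ (ENNReal.ofReal p) μ) :
    ‖f‖ ^ p = ∫ a, |f a| ^ p ∂μ := by
  have h := (Lp.memLp f).eLpNorm_eq_integral_rpow_norm (by simpa using hp) ENNReal.ofReal_ne_top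
  have h0 : 0 ≤ ∫ a, |f a| ^ p ∂μ := integral_nonneg fun a => by positivity
  simp only [ENNReal.toReal_ofReal hp.le, Real.norm_eq_abs] at h
  rw [Lp.norm_def, h, ENNReal.toReal_ofReal (by positivity), ← Real.rpow_mul h0,
    inv_mul_cancel₀ hp.ne', Real.rpow_one]

theorem Lp_integral_mean (hp : 0 < p) (f g : Lp ℝ (ENNReal.ofReal p) μ) :
    Integrable (fun a => (|f a + g a| ^ p + |f a - g a| ^ p) / 2) μ ∧
    ∫ a, (|f a + g a| ^ p + |f a - g a| ^ p) / 2 ∂μ = (‖f + g‖ ^ p + ‖f - g‖ ^ p) / 2 := by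
  have h1 : (fun a => |(f + g) a| ^ p) =ᵐ[μ] fun a => |f a + g a| ^ p := by
    filter_upwards [Lp.coeFn_add f g] with a ha
    rw [ha, Pi.add_apply]
  have h2 : (fun a => |(f - g) a| ^ p) =ᵐ[μ] fun a => |f a - g a| ^ p := by
    filter_upwards [Lp.coeFn_sub f g] with a ha
    rw [ha, Pi.sub_apply]
  have i1 := (Lp_integrable_rpow hp (f + g)).congr h1
  have i2 := (Lp_integrable_rpow hp (f - g)).congr h2
  refine ⟨(i1.add i2).div_const 2, ?_⟩
  rw [integral_div, integral_add i1 i2, Lp_norm_rpow hp, Lp_norm_rpow hp, integral_congr_ae h1,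
    integral_congr_ae h2]

theorem Lp_uniformlyConvex_of_two_le [Fact (1 ≤ ENNReal.ofReal p)] (hp : 2 ≤ p) :
    IsUniformlyConvexWith (Lp ℝ (ENNReal.ofReal p) μ) p 1 := by
  intro f g
  have hp0 : 0 < p := by linarith
  obtain ⟨hi, he⟩ := Lp_integral_mean hp0 f g
  have i1 := Lp_integrable_rpow hp0 f
  have i2 := Lp_integrable_rpow hp0 g
  rw [one_mul, ← he, Lp_norm_rpow hp0, Lp_norm_rpow hp0, ← integral_add i1 i2]
  exact integral_mono (i1.add i2) hi fun a => rpow_add_rpow_le_mean hp (f a) (g a)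

/-- Hölder's inequality is applied pointwise with the constant weights X = ‖f‖ and Y = d‖g‖, its
equality case for the integrated norms. Integration gives W ≤ mean · W^((2-p)/2) for W = X² + Y²;
cancelling bounds W^(p/2) by a mean of p-th powers, and convexity of the power 2/p turns this into
squares. -/
theorem Lp_uniformlyConvex_of_lt_two [Fact (1 ≤ ENNReal.ofReal p)] (hp : 1 < p) (hp' : p < 2) :
    IsUniformlyConvexWith (Lp ℝ (ENNReal.ofReal p) μ) 2 ((p - 1) / 2) := by
  intro f g
  have hp0 : 0 < p := by linarith
  obtain ⟨hi, he⟩ := Lp_integral_mean hp0 f g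
  have i1 := Lp_integrable_rpow hp0 f
  have i2 := Lp_integrable_rpow hp0 g
  set d := Real.sqrt ((p - 1) / 2) with hd
  have hd2 : d ^ 2 = (p - 1) / 2 := Real.sq_sqrt (by linarith)
  have hd0 : 0 ≤ d := Real.sqrt_nonneg _
  set X := ‖f‖ with hX
  set Y := d * ‖g‖ with hY
  have hX0 : 0 ≤ X := norm_nonneg _
  have hY0 : 0 ≤ Y := mul_nonneg hd0 (norm_nonneg _)
  set W := X ^ 2 + Y ^ 2 with hW
  have hW0 : 0 ≤ W := by positivity
  have hpt : ∀ a, |f a| ^ p * X ^ (2 - p) + |g a| ^ p * (d ^ p * Y ^ (2 - p)) ≤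
      (|f a + g a| ^ p + |f a - g a| ^ p) / 2 * W ^ ((2 - p) / 2) := by
    intro a
    have h1 := rpow_mul_add_rpow_mul_le hp0 hp' (abs_nonneg (f a))
      (mul_nonneg hd0 (abs_nonneg (g a))) hX0 hY0
    have h2 := rpow_half_le_mean hp hp'.le (f a) (g a)
    rw [mul_pow, sq_abs, sq_abs, hd2, Real.mul_rpow hd0 (abs_nonneg _)] at h1
    calc _ = |f a| ^ p * X ^ (2 - p) + d ^ p * |g a| ^ p * Y ^ (2 - p) := by ring
      _ ≤ _ := h1
      _ ≤ _ := mul_le_mul_of_nonneg_right h2 (by positivity)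
  have hint := integral_mono ((i1.mul_const _).add (i2.mul_const _)) (hi.mul_const _) hpt
  simp only [Pi.add_apply] at hint
  rw [integral_add (i1.mul_const _) (i2.mul_const _), integral_mul_const, integral_mul_const,
    integral_mul_const, he, ← Lp_norm_rpow hp0, ← Lp_norm_rpow hp0, ← mul_assoc, mul_comm (‖g‖ ^ p),
    ← Real.mul_rpow hd0 (norm_nonneg _), ← hY, ← hX] at hint
  have hsq : ∀ z : ℝ, 0 ≤ z → z ^ p * z ^ (2 - p) = z ^ 2 := fun z hz => by
    rw [← Real.rpow_add_of_nonneg hz hp0.le (by linarith)]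
    norm_num
  rw [hsq X hX0, hsq Y hY0, ← hW] at hint
  have hgoal : W ≤ (‖f + g‖ ^ 2 + ‖f - g‖ ^ 2) / 2 := by
    rcases hW0.eq_or_lt with h0 | h0
    · rw [← h0]; positivity
    have h1 : W ^ (p / 2) ≤ (‖f + g‖ ^ p + ‖f - g‖ ^ p) / 2 := by
      have h2 : W = W ^ (p / 2) * W ^ ((2 - p) / 2) := by
        rw [← Real.rpow_add h0]
        ring_nf
        rw [Real.rpow_one]
      refine le_of_mul_le_mul_right ?_ (Real.rpow_pos_of_pos h0 ((2 - p) / 2))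
      rw [← h2]; exact hint
    have hr : 1 ≤ 2 / p := by rw [le_div_iff₀ hp0]; linarith
    have e1 : ∀ z : ℝ, 0 ≤ z → (z ^ p) ^ (2 / p) = z ^ 2 := fun z hz => by
      rw [← Real.rpow_mul hz, mul_div_cancel₀ _ hp0.ne']; norm_num
    have e2 : (W ^ (p / 2)) ^ (2 / p) = W := by
      rw [← Real.rpow_mul hW0, div_mul_div_cancel₀ (by norm_num), div_self hp0.ne', Real.rpow_one]
    calc W = (W ^ (p / 2)) ^ (2 / p) := e2.symm
      _ ≤ ((‖f + g‖ ^ p + ‖f - g‖ ^ p) / 2) ^ (2 / p) :=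
        Real.rpow_le_rpow (by positivity) h1 (by positivity)
      _ ≤ ((‖f + g‖ ^ p) ^ (2 / p) + (‖f - g‖ ^ p) ^ (2 / p)) / 2 :=
        rpow_mean_le (by positivity) (by positivity) hr
      _ = _ := by rw [e1 _ (norm_nonneg _), e1 _ (norm_nonneg _)]
  rw [hW, hY, mul_pow, hd2] at hgoal
  simpa only [Real.rpow_two] using hgoal

end Lp

/-- Uniform convexity measures how far y is from the midpoint of x and z, and of x and w. The two
deviations 2y - x - z and 2y - x - w differ by z - w, so they cannot both be small. -/
theorem IsUniformlyConvexWith.isForkConvex {E : Type*} [NormedAddCommGroup E] [NormedSpace ℝ E]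
    {q c : ℝ} (hq : 1 ≤ q) (hc : 0 ≤ c) (h : IsUniformlyConvexWith E q c) :
    IsForkConvex E q (ENNReal.ofReal (c * 4 ^ (1 - q))) := by
  have hq0 : 0 ≤ q := by linarith
  have half : ∀ u : E, ‖(2⁻¹ : ℝ) • u‖ ^ q = 2 ^ (-q) * ‖u‖ ^ q := fun u => by
    rw [norm_smul, Real.mul_rpow (norm_nonneg _) (norm_nonneg _)]
    rw [Real.norm_of_nonneg (by norm_num), Real.inv_rpow (by norm_num), Real.rpow_neg (by norm_num)]
  have tri : ∀ a b : E, 2 ^ (-q) * (‖a‖ ^ q + c * ‖b - (a - b)‖ ^ q) ≤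
      (‖b‖ ^ q + ‖a - b‖ ^ q) / 2 := by
    intro a b
    have h1 := h ((2⁻¹ : ℝ) • a) ((2⁻¹ : ℝ) • (b - (a - b)))
    rw [half, half, show (2⁻¹ : ℝ) • a + (2⁻¹ : ℝ) • (b - (a - b)) = b by module,
      show (2⁻¹ : ℝ) • a - (2⁻¹ : ℝ) • (b - (a - b)) = a - b by module] at h1
    linarith
  have real : ∀ x y z w : E, 2 ^ (1 - q) * (‖x - z‖ ^ q + ‖x - w‖ ^ q) +
      c * 4 ^ (1 - q) * ‖z - w‖ ^ q ≤ ‖y - z‖ ^ q + ‖y - w‖ ^ q + 2 * ‖x - y‖ ^ q := by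
    intro x y z w
    have h1 := tri (x - z) (y - z)
    have h2 := tri (x - w) (y - w)
    have h3 : ((‖z - w‖) / 2) ^ q ≤ (‖(y - z) - (x - z - (y - z))‖ ^ q +
        ‖(y - w) - (x - w - (y - w))‖ ^ q) / 2 := by
      refine le_trans (Real.rpow_le_rpow (by positivity) ?_ hq0)
        (rpow_mean_le (norm_nonneg _) (norm_nonneg _) hq)
      have : z - w = (y - w - (x - w - (y - w))) - (y - z - (x - z - (y - z))) := by abel
      have := this ▸ norm_sub_le (y - w - (x - w - (y - w))) (y - z - (x - z - (y - z)))
      linarith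
    rw [show x - z - (y - z) = x - y by abel] at h1 h3
    rw [show x - w - (y - w) = x - y by abel] at h2 h3
    have e1 : (2 : ℝ) ^ (1 - q) = 2 * 2 ^ (-q) := by
      rw [sub_eq_add_neg, Real.rpow_add (by norm_num), Real.rpow_one]
    have e2 : (4 : ℝ) ^ (1 - q) = 4 * (2 ^ (-q) * 2 ^ (-q)) := by
      rw [sub_eq_add_neg, Real.rpow_add (by norm_num), Real.rpow_one,
        ← Real.mul_rpow (by norm_num) (by norm_num)]
      norm_num
    have e3 : (‖z - w‖ / 2) ^ q = 2 ^ (-q) * ‖z - w‖ ^ q := by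
      rw [Real.div_rpow (norm_nonneg _) (by norm_num), Real.rpow_neg (by norm_num)]
      field_simp
    rw [e3] at h3
    rw [e1, e2]
    have h4 := mul_le_mul_of_nonneg_left h3
      (mul_nonneg hc (Real.rpow_nonneg (by norm_num : (0 : ℝ) ≤ 2) (-q)))
    linarith
  intro x y z w
  have e : ∀ u v : E, edist u v ^ q = ENNReal.ofReal (‖u - v‖ ^ q) := fun u v => by
    rw [edist_dist, dist_eq_norm, ENNReal.ofReal_rpow_of_nonneg (norm_nonneg _) hq0]
  have e2 : (2 : ℝ≥0∞) ^ (1 - q) = ENNReal.ofReal (2 ^ (1 - q)) := by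
    rw [← ENNReal.ofReal_rpow_of_pos (by norm_num)]
    norm_num
  have e3 : (2 : ℝ≥0∞) = ENNReal.ofReal 2 := by norm_num
  rw [e2]
  rw [e3]
  simp only [e]
  rw [← ENNReal.ofReal_add (by positivity) (by positivity), ← ENNReal.ofReal_mul (by positivity),
    ← ENNReal.ofReal_mul (by positivity), ← ENNReal.ofReal_add (by positivity) (by positivity),
    ← ENNReal.ofReal_add (by positivity) (by positivity), ← ENNReal.ofReal_mul (by positivity),
    ← ENNReal.ofReal_add (by positivity) (by positivity)]
  exact ENNReal.ofReal_le_ofReal (real x y z w)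

theorem markovConvexity_le_lpDistortion {p : ℝ} (hp : 1 < p) : ∃ κ : ℝ≥0, 0 < κ ∧
    ∀ (X : Type) [MetricSpace X],
      (κ : ℝ≥0∞) * markovConvexity (max 2 p) X ≤ lpDistortion p X := by
  have : Fact (1 ≤ ENNReal.ofReal p) := ⟨by simpa using hp.le⟩
  set q := max 2 p with hq
  have hq1 : 1 ≤ q := le_trans (by norm_num) (le_max_left _ _)
  obtain ⟨c, hc, hU⟩ : ∃ c : ℝ, 0 < c ∧ IsUniformlyConvexWith (Lp ℝ (ENNReal.ofReal p)
      (volume.restrict (Set.Icc (0 : ℝ) 1))) q c := by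
    rcases le_or_gt 2 p with h | h
    · rw [hq, max_eq_right h]
      exact ⟨1, one_pos, Lp_uniformlyConvex_of_two_le h⟩
    · rw [hq, max_eq_left h.le]
      exact ⟨(p - 1) / 2, by linarith, Lp_uniformlyConvex_of_lt_two hp h⟩
  have hc' : 0 < Real.toNNReal (c * 4 ^ (1 - q)) := Real.toNNReal_pos.2 (by positivity)
  have hM := IsForkConvex.isMarkovConvexWith (by linarith : 0 < q) hc'
    (hU.isForkConvex hq1 hc.le)
  set C := (4 / Real.toNNReal (c * 4 ^ (1 - q))) ^ (1 / q) with hC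
  have hC0 : 0 < C := by positivity
  refine ⟨C⁻¹, by positivity, fun X _ => ?_⟩
  have h := markovConvexity_le_distortion (X := X) (by linarith : 0 < q) hC0 hM
  rw [ENNReal.coe_inv hC0.ne', mul_comm, ← div_eq_mul_inv]
  exact ENNReal.div_le_of_le_mul' h

/-! ### The random descent in a Cantor tree -/

namespace Cantor

variable {i : ℕ}

/-- The child `0` or `1` of a vertex; the only child or the vertex itself if there are fewer. -/
def child (v : Cantor i) (b : Bool) : Cantor i :=
  if h : b.toNat < (cantorDegrees i).getD v.1.length 0 then SST.snoc v b.toNat h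
  else if h : 0 < (cantorDegrees i).getD v.1.length 0 then SST.snoc v 0 h else v

theorem child_of_two {v : Cantor i} (h : (cantorDegrees i).getD v.1.length 0 = 2) (b : Bool) :
    (v.child b).1 = v.1 ++ [b.toNat] := by
  have : b.toNat < (cantorDegrees i).getD v.1.length 0 := by rw [h]; cases b <;> simp
  rw [child, dif_pos this, SST.snoc]

theorem exists_child_eq {v : Cantor i} (h : v.1.length < height i) (b : Bool) :
    ∃ x, (v.child b).1 = v.1 ++ [x] := by
  rw [child]
  split_ifs with h1 h2
  · exact ⟨_, rfl⟩
  · exact ⟨_, rfl⟩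
  · exact absurd (getD_cantorDegrees_pos_iff.2 h) h2

theorem child_of_height_le {v : Cantor i} (h : height i ≤ v.1.length) (b : Bool) :
    v.child b = v := by
  have := getD_cantorDegrees_of_ge h
  rw [child, dif_neg (by rw [this]; omega), dif_neg (by rw [this]; omega)]

/-- One step of the random descent: a uniformly random child, if there is one. -/
def descend (v : Cantor i) : PMF (Cantor i) := (PMF.uniformOfFintype Bool).map v.child

theorem expect_descend (v : Cantor i) (g : Cantor i → ℝ≥0∞) :
    expect v.descend g = 2⁻¹ * g (v.child true) + 2⁻¹ * g (v.child false) := by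
  rw [descend, expect_map, expect, tsum_fintype]
  simp

theorem length_of_mem_support {t : ℕ} {v : Cantor i}
    (h : v ∈ (chainLaw (PMF.pure (SST.root (cantorDegrees i))) descend t).support) :
    v.1.length = min t (height i) := by
  induction t generalizing v with
  | zero =>
    rw [chainLaw, PMF.mem_support_pure_iff] at h
    simp [h, SST.root]
  | succ t ih =>
    rw [chainLaw, PMF.mem_support_bind_iff] at h
    obtain ⟨u, hu, hv⟩ := h
    have h1 := ih hu
    rw [descend, PMF.mem_support_map_iff] at hv
    obtain ⟨b, -, rfl⟩ := hv
    rcases Nat.lt_or_ge u.1.length (height i) with h2 | h2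
    · obtain ⟨x, hx⟩ := exists_child_eq h2 b
      rw [hx, List.length_append, List.length_singleton]
      omega
    · rw [child_of_height_le h2]
      omega

/-- The letter at the branching level a is a fair coin, tossed in the step that leaves level a;
before that step the probability is 1/2, afterwards it is settled. -/
theorem expect_letter {t a : ℕ} (ht : t ≤ height i) (hat : a < t)
    (ha : (cantorDegrees i).getD a 0 = 2) (b : Bool) (n : ℕ) (v : Cantor i)
    (hv : v.1.length + n = t) :
    expect (chainLaw (PMF.pure v) descend n)
      (fun y => if y.1.length = t ∧ y.1[a]? = some b.toNat then 1 else 0) =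
    if a < v.1.length then (if v.1[a]? = some b.toNat then 1 else 0) else 2⁻¹ := by
  induction n generalizing v with
  | zero =>
    have h1 : a < v.1.length := by omega
    have h2 : v.1.length = t := hv
    rw [chainLaw, expect_pure, if_pos h1]
    simp only [h2, true_and]
  | succ n ih =>
    have hlen : ∀ b', (v.child b').1.length = v.1.length + 1 := fun b' => by
      obtain ⟨x, hx⟩ := exists_child_eq (v := v) (by omega) b'
      simp [hx]
    rw [chainLaw_pure_succ, expect_bind, expect_descend, ih _ (by rw [hlen]; omega),
      ih _ (by rw [hlen]; omega), hlen, hlen]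
    rcases lt_trichotomy a v.1.length with h | h | h
    · have hget : ∀ b', (v.child b').1[a]? = v.1[a]? := fun b' => by
        obtain ⟨x, hx⟩ := exists_child_eq (v := v) (by omega) b'
        rw [hx, List.getElem?_append_left h]
      rw [hget, hget, if_pos h, if_pos (by omega), ← add_mul, ENNReal.inv_two_add_inv_two,
        one_mul]
    · subst h
      rw [child_of_two ha, child_of_two ha, if_pos (Nat.lt_succ_self _), if_pos (Nat.lt_succ_self _),
        if_neg (lt_irrefl _)]
      cases b <;> simp
    · have h1 : ¬ a < v.1.length + 1 := by omega
      have h2 : ¬ a < v.1.length := by omega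
      rw [if_neg h1, if_neg h1, if_neg h2, ← add_mul, ENNReal.inv_two_add_inv_two, one_mul]

/-- Two independent descents take different children at level a with probability 1/4 + 1/4, and are
then at distance at least 2(t - a) ≥ R. -/
theorem le_expect_edist {p : ℝ} (hp : 0 < p) {t a n R : ℕ} (ht : t ≤ height i) (hat : a < t)
    (ha : (cantorDegrees i).getD a 0 = 2) (hR : R + 2 * a ≤ 2 * t) (v : Cantor i)
    (hv : v.1.length + n = t) (hva : v.1.length ≤ a) :
    2⁻¹ * (R : ℝ≥0∞) ^ p ≤ expect (chainLaw (PMF.pure v) descend n) fun y =>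
      expect (chainLaw (PMF.pure v) descend n) fun z => edist y z ^ p := by
  set I : Bool → Cantor i → ℝ≥0∞ := fun b y =>
    if y.1.length = t ∧ y.1[a]? = some b.toNat then 1 else 0 with hI
  have hE : ∀ b, expect (chainLaw (PMF.pure v) descend n) (I b) = 2⁻¹ := fun b => by
    rw [hI, expect_letter ht hat ha b n v hv, if_neg (by omega)]
  have hpt : ∀ y z : Cantor i, (R : ℝ≥0∞) ^ p * (I true y * I false z) +
      (R : ℝ≥0∞) ^ p * (I false y * I true z) ≤ edist y z ^ p := by
    intro y z
    have key : ∀ b b' : Bool, b ≠ b' → (y.1.length = t ∧ y.1[a]? = some b.toNat) →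
        (z.1.length = t ∧ z.1[a]? = some b'.toNat) → (R : ℝ≥0∞) ^ p ≤ edist y z ^ p := by
      rintro b b' hbb ⟨h1, h2⟩ ⟨h3, h4⟩
      refine ENNReal.rpow_le_rpow ?_ hp.le
      rw [SST.edist_eq]
      have := le_wordDist_of_getElem?_ne (l := y.1) (l' := z.1) (a := a)
        (by rw [h2, h4]; cases b <;> cases b' <;> simp_all)
      exact_mod_cast (by omega : R ≤ wordDist y.1 z.1)
    simp only [hI]
    by_cases h1 : y.1.length = t ∧ y.1[a]? = some true.toNat
    · have h2 : ¬ (y.1.length = t ∧ y.1[a]? = some false.toNat) := by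
        rintro ⟨-, h⟩; rw [h1.2] at h; simp at h
      rw [if_pos h1, if_neg h2]
      split_ifs with h3 h4
      · simpa using key true false (by simp) h1 h3
      · simpa using key true false (by simp) h1 h3
      · simp
      · simp
    · rw [if_neg h1]
      by_cases h2 : y.1.length = t ∧ y.1[a]? = some false.toNat
      · rw [if_pos h2]
        split_ifs with h3 h4
        · simpa using key false true (by simp) h2 h4
        · simp
        · simpa using key false true (by simp) h2 (by assumption)
        · simp
      · rw [if_neg h2]; simp
  refine le_trans (le_of_eq ?_) (expect_mono _ fun y _ => expect_mono _ fun z _ => hpt y z)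
  simp only [expect_add, expect_const_mul, hE]
  have : ∀ b, expect (chainLaw (PMF.pure v) descend n) (fun y => I b y * 2⁻¹) = 2⁻¹ * 2⁻¹ := by
    intro b
    simp only [mul_comm _ (2⁻¹ : ℝ≥0∞), expect_const_mul, hE]
  rw [this, this, ← mul_add, ← mul_add, ENNReal.inv_two_add_inv_two, mul_one, mul_comm]

theorem expect_stepLaw_le {p : ℝ} (hp : 0 < p) (t : ℕ) :
    expect (stepLaw (PMF.pure (SST.root (cantorDegrees i))) descend t)
      (fun z => edist z.2 z.1 ^ p) ≤ if t < height i then 1 else 0 := by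
  rw [expect_stepLaw, pairExpect, Nat.add_sub_cancel_left]
  refine (expect_mono _ (g' := fun _ => if t < height i then 1 else 0) fun v hv => ?_).trans_eq
    (expect_const _ _)
  have hlen := length_of_mem_support hv
  have hc : ∀ b, edist (child v b) v ^ p ≤ if t < height i then (1 : ℝ≥0∞) else 0 := by
    intro b
    split_ifs with h
    · obtain ⟨x, hx⟩ := exists_child_eq (v := v) (by omega) b
      have := wordDist_of_prefix (List.prefix_append v.1 [x])
      rw [edist_comm, SST.edist_eq, hx, this]
      simp
    · rw [child_of_height_le (by omega), edist_self, ENNReal.zero_rpow_of_pos hp]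
  simp only [chainLaw, PMF.pure_bind, expect_descend]
  calc _ ≤ 2⁻¹ * (if t < height i then (1 : ℝ≥0∞) else 0) +
        2⁻¹ * (if t < height i then (1 : ℝ≥0∞) else 0) :=
        add_le_add (mul_le_mul_right (hc true) _) (mul_le_mul_right (hc false) _)
    _ = _ := by rw [← add_mul, ENNReal.inv_two_add_inv_two, one_mul]

end Cantor

/-! ### Lower bound for the Markov convexity constants -/

open Classical in
/-- The times `t` such that one of the levels between `t - 2 ^ (k + 1)` and `t - 2 ^ k` is
branching. -/
def splitTimes (i k : ℕ) : Finset ℕ :=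
  (Finset.Icc 1 (height i)).filter fun t =>
    ∃ a, (cantorSeq i).getD a 0 = 2 ∧ a + 2 ^ k ≤ t ∧ t ≤ a + 2 ^ (k + 1)

theorem mem_splitTimes {i k t : ℕ} : t ∈ splitTimes i k ↔ (1 ≤ t ∧ t ≤ height i) ∧
    ∃ a, (cantorSeq i).getD a 0 = 2 ∧ a + 2 ^ k ≤ t ∧ t ≤ a + 2 ^ (k + 1) := by
  classical
  rw [splitTimes, Finset.mem_filter, Finset.mem_Icc]

/-- Adding 2^k to a level counted by `nearCount` gives a split time, unless it passes the height;
that loses at most 2^k - 1 levels, which the factor 2 absorbs. -/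
theorem le_card_splitTimes {i k : ℕ} (hk : k < i) :
    (k + 1) * 2 ^ (i - 1) ≤ 2 * (splitTimes i k).card := by
  classical
  obtain ⟨n, rfl⟩ : ∃ n, i = k + 1 + n := Nat.exists_eq_add_of_le hk
  have h1 := le_nearCount n k
  set N := (Finset.range (height (k + 1 + n))).filter fun x =>
    ∃ a, (cantorSeq (k + 1 + n)).getD a 0 = 2 ∧ a ≤ x ∧ x ≤ a + 2 ^ k with hN
  have hcard : nearCount (k + 1 + n) k = N.card := by
    rw [nearCount, hN]
  have hp := Nat.two_pow_pos k
  have hsub : N ⊆ ((splitTimes (k + 1 + n) k).image fun t => t - 2 ^ k) ∪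
      Finset.Ico (height (k + 1 + n) + 1 - 2 ^ k) (height (k + 1 + n)) := by
    intro x hx
    rw [hN, Finset.mem_filter, Finset.mem_range] at hx
    obtain ⟨hx1, a, ha1, ha2, ha3⟩ := hx
    rw [Finset.mem_union]
    by_cases h : x + 2 ^ k ≤ height (k + 1 + n)
    · left
      refine Finset.mem_image.2 ⟨x + 2 ^ k, ?_, by omega⟩
      rw [mem_splitTimes]
      exact ⟨⟨by omega, h⟩, a, ha1, by omega, by rw [pow_succ]; omega⟩
    · right
      rw [Finset.mem_Ico]
      omega
  have h2 := (Finset.card_le_card hsub).trans (Finset.card_union_le _ _)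
  have h3 := Finset.card_image_le (s := splitTimes (k + 1 + n) k) (f := fun t => t - 2 ^ k)
  rw [Nat.card_Ico] at h2
  have h4 : 2 * 2 ^ k ≤ (k + 1) * 2 ^ (k + n) + 2 := by
    rcases Nat.eq_zero_or_pos k with rfl | hk0
    · simp
    · have : 2 ^ k ≤ 2 ^ (k + n) := Nat.pow_le_pow_right (by norm_num) (by omega)
      have := Nat.mul_le_mul (by omega : 2 ≤ k + 1) this
      omega
  have h5 : k + 1 + n - 1 = k + n := by omega
  rw [h5]
  omega

theorem le_sum_card_splitTimes (i : ℕ) :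
    i * height i ≤ 4 * ∑ k ∈ Finset.range i, (splitTimes i k).card := by
  rcases Nat.eq_zero_or_pos i with rfl | hi
  · simp
  have h1 : ∑ k ∈ Finset.range i, (k + 1) * 2 ^ (i - 1) ≤
      ∑ k ∈ Finset.range i, 2 * (splitTimes i k).card :=
    Finset.sum_le_sum fun k hk => le_card_splitTimes (Finset.mem_range.1 hk)
  rw [← Finset.mul_sum, ← Finset.sum_mul] at h1
  have h2 : ∀ n : ℕ, (∑ k ∈ Finset.range n, (k + 1)) * 2 = n * (n + 1) := by
    intro n
    induction n with
    | zero => simp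
    | succ n ih => rw [Finset.sum_range_succ, add_mul, ih]; ring
  have h3 : height i = i * 2 ^ (i - 1) := by
    have h4 := two_mul_height i
    have h5 : 2 ^ i = 2 * 2 ^ (i - 1) := by
      rw [← pow_succ', Nat.sub_add_cancel hi]
    rw [h5] at h4
    linarith
  have h4 := h2 i
  rw [h3]
  nlinarith [Nat.two_pow_pos (i - 1)]

/-- The Markov convexity constants of the Cantor trees. -/
theorem le_markovConvexity_cantor {p : ℝ} (hp : 0 < p) (i : ℕ) :
    (((1 / 8 : ℝ≥0) : ℝ≥0∞) * i) ^ (1 / p) ≤ markovConvexity p (Cantor i) := by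
  rcases Nat.eq_zero_or_pos i with rfl | hi
  · simp [hp]
  refine le_iInf₂ fun C hC => ?_
  have hh : i ≤ height i := by
    have := two_mul_height i
    have h2 : 2 ≤ 2 ^ i := by
      calc 2 = 2 ^ 1 := by norm_num
        _ ≤ 2 ^ i := Nat.pow_le_pow_right (by norm_num) hi
    nlinarith
  -- Any m will do for which 2^m time steps cover the descent and the scales up to 2^i occur; the
  -- chain rests at a leaf afterwards and adds nothing to the right side.
  set m := height i with hm
  have hmm : m ≤ 2 ^ m := Nat.lt_two_pow_self.le
  have hC' := hC (Cantor i) (PMF.pure (SST.root (cantorDegrees i))) Cantor.descend id m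
  simp only [id] at hC'
  have hR : ∑ t ∈ Finset.Icc 1 (2 ^ m), expect (stepLaw (PMF.pure (SST.root (cantorDegrees i)))
      Cantor.descend (t - 1)) (fun z => edist z.2 z.1 ^ p) ≤ (m : ℝ≥0∞) := by
    calc _ ≤ ∑ t ∈ Finset.Icc 1 (2 ^ m), if t ∈ Finset.Icc 1 m then (1 : ℝ≥0∞) else 0 := by
          refine Finset.sum_le_sum fun t ht => (Cantor.expect_stepLaw_le hp (t - 1)).trans_eq ?_
          rw [Finset.mem_Icc] at ht
          congr 1
          rw [Finset.mem_Icc, eq_iff_iff]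
          omega
      _ ≤ _ := by
          rw [← Finset.sum_filter, Finset.sum_const, nsmul_eq_mul, mul_one]
          have : (Finset.Icc 1 (2 ^ m)).filter (· ∈ Finset.Icc 1 m) ⊆ Finset.Icc 1 m :=
            fun t ht => (Finset.mem_filter.1 ht).2
          exact_mod_cast (Finset.card_le_card this).trans (by simp)
  have hL : ∀ k ∈ Finset.range i, 2⁻¹ * ((splitTimes i k).card : ℝ≥0∞) ≤
      ∑ t ∈ Finset.Icc 1 (2 ^ m), expect (splitLaw (PMF.pure (SST.root (cantorDegrees i)))
        Cantor.descend (t - 2 ^ (k + 1)) t) (fun z => edist z.1 z.2 ^ p) /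
          (2 : ℝ≥0∞) ^ (((k + 1 : ℕ) : ℝ) * p) := by
    intro k _
    have hsub : splitTimes i k ⊆ Finset.Icc 1 (2 ^ m) := fun t ht => by
      rw [mem_splitTimes] at ht
      rw [Finset.mem_Icc]
      omega
    refine le_trans ?_ (Finset.sum_le_sum_of_subset hsub)
    rw [mul_comm, ← nsmul_eq_mul, ← Finset.sum_const]
    refine Finset.sum_le_sum fun t ht => ?_
    rw [mem_splitTimes] at ht
    obtain ⟨⟨ht1, ht2⟩, a, ha1, ha2, ha3⟩ := ht
    have hpow := Nat.two_pow_pos k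
    have hpow' : 2 ^ (k + 1) = 2 * 2 ^ k := pow_succ' 2 k
    have hpos : (2 : ℝ≥0∞) ^ (((k + 1 : ℕ) : ℝ) * p) ≠ 0 := by simp
    have htop : (2 : ℝ≥0∞) ^ (((k + 1 : ℕ) : ℝ) * p) ≠ ⊤ := by simp
    rw [ENNReal.le_div_iff_mul_le (Or.inl hpos) (Or.inl htop), expect_splitLaw]
    refine (expect_const (chainLaw (PMF.pure (SST.root (cantorDegrees i))) Cantor.descend
      (t - 2 ^ (k + 1))) _).symm.le.trans (expect_mono _ fun v hv => ?_)
    have hlen := Cantor.length_of_mem_support hv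
    have hpR : (2 : ℝ≥0∞) ^ (((k + 1 : ℕ) : ℝ) * p) = ((2 ^ (k + 1) : ℕ) : ℝ≥0∞) ^ p := by
      rw [ENNReal.rpow_mul, ENNReal.rpow_natCast]; norm_cast
    rw [hpR]
    exact Cantor.le_expect_edist hp (a := a) ht2 (by omega)
      (by rw [getD_cantorDegrees_of_lt (by omega), ha1]) (by omega) v (by omega) (by omega)
  have hsum : 2⁻¹ * ((∑ k ∈ Finset.range i, (splitTimes i k).card : ℕ) : ℝ≥0∞) ≤
      (C : ℝ≥0∞) ^ p * m := by
    refine le_trans ?_ (hC'.trans (mul_le_mul_right hR _))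
    -- Only the scales 2^(k+1) with k < i are used; the scale 2^0 is dropped.
    rw [Finset.sum_range_succ']
    refine le_trans ?_ le_self_add
    push_cast
    rw [Finset.mul_sum]
    refine (Finset.sum_le_sum hL).trans ?_
    push_cast
    exact Finset.sum_le_sum_of_subset (Finset.range_mono hh)
  have hcount : ((i * m : ℕ) : ℝ≥0∞) ≤
      4 * ((∑ k ∈ Finset.range i, (splitTimes i k).card : ℕ) : ℝ≥0∞) := by
    exact_mod_cast le_sum_card_splitTimes i
  have hm0 : (m : ℝ≥0∞) ≠ 0 := by
    have : m ≠ 0 := by omega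
    exact_mod_cast this
  have h8 : (i : ℝ≥0∞) * m ≤ 8 * (C : ℝ≥0∞) ^ p * m := by
    calc (i : ℝ≥0∞) * m ≤ 4 * ((∑ k ∈ Finset.range i, (splitTimes i k).card : ℕ) : ℝ≥0∞) := by
          exact_mod_cast hcount
      _ = 8 * (2⁻¹ * ((∑ k ∈ Finset.range i, (splitTimes i k).card : ℕ) : ℝ≥0∞)) := by
          rw [← mul_assoc]
          congr 1
          rw [show (8 : ℝ≥0∞) = 4 * 2 by norm_num, mul_assoc,
            ENNReal.mul_inv_cancel (by norm_num) (by norm_num), mul_one]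
      _ ≤ 8 * ((C : ℝ≥0∞) ^ p * m) := mul_le_mul_right hsum _
      _ = _ := by rw [mul_assoc]
  have h9 : (i : ℝ≥0∞) ≤ 8 * (C : ℝ≥0∞) ^ p :=
    (ENNReal.mul_le_mul_iff_left hm0 (ENNReal.natCast_ne_top m)).1 h8
  have h10 : ((1 / 8 : ℝ≥0) : ℝ≥0∞) * i ≤ (C : ℝ≥0∞) ^ p := by
    calc ((1 / 8 : ℝ≥0) : ℝ≥0∞) * i ≤ ((1 / 8 : ℝ≥0) : ℝ≥0∞) * (8 * (C : ℝ≥0∞) ^ p) :=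
          mul_le_mul_right h9 _
      _ = _ := by
          rw [← mul_assoc]
          have : ((1 / 8 : ℝ≥0) : ℝ≥0∞) * 8 = 1 := by
            rw [show (8 : ℝ≥0∞) = ((8 : ℝ≥0) : ℝ≥0∞) by rfl, ← ENNReal.coe_mul]
            norm_num
          rw [this, one_mul]
  calc _ ≤ ((C : ℝ≥0∞) ^ p) ^ (1 / p) := ENNReal.rpow_le_rpow h10 (by positivity)
    _ = C := by rw [← ENNReal.rpow_mul, mul_one_div_cancel hp.ne', ENNReal.rpow_one]

/-! ### Binary trees in Cantor trees -/

theorem wordDist_le_add (l l' : List ℕ) : wordDist l l' ≤ l.length + l'.length := by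
  obtain ⟨w, x, y, rfl, rfl, h⟩ := exists_wordDist_eq l l'
  simp only [List.length_append]
  omega

/-- A path leaving the subtree below p passes through p. -/
theorem length_sub_le_wordDist {p l l' : List ℕ} (h : p <+: l) (h' : ¬ p <+: l') :
    l.length - p.length ≤ wordDist l l' := by
  obtain ⟨w, x, y, rfl, rfl, hd⟩ := exists_wordDist_eq l l'
  have : w.length < p.length := by
    by_contra hlt
    push Not at hlt
    exact h' ((List.prefix_of_prefix_length_le h (List.prefix_append w x) hlt).trans
      (List.prefix_append w y))
  simp only [List.length_append]
  omega

theorem length_add_le_of_wordDist {l l' : List ℕ} :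
    l.length ≤ l'.length + wordDist l l' ∧ l'.length ≤ l.length + wordDist l l' := by
  obtain ⟨w, x, y, rfl, rfl, h⟩ := exists_wordDist_eq l l'
  simp only [List.length_append]
  omega

namespace SST

variable {s : List ℕ}

/-- A ball around the midpoint of a non-branching stretch of the tree is a path. -/
theorem prefix_of_free {y N : ℕ} (hfree : ∀ z, y < z → z < y + 2 * N → s.getD z 0 ≤ 1)
    {p u v : SST s} (hp : p.1.length = y + N) (hu : wordDist p.1 u.1 < N)
    (hv : wordDist p.1 v.1 < N) (huv : u.1.length ≤ v.1.length) : u.1 <+: v.1 := by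
  -- A vertex within distance less than N of p shares the letters of p up to level y; its later
  -- letters are 0, as these levels do not branch.
  have key : ∀ u : SST s, wordDist p.1 u.1 < N →
      u.1.length < y + 2 * N ∧ ∀ z ≤ y, u.1[z]? = p.1[z]? := by
    intro u hu
    have h1 := (length_add_le_of_wordDist (l := p.1) (l' := u.1)).2
    refine ⟨by omega, fun z hz => ?_⟩
    obtain ⟨w, x, x', h2, h3, h4⟩ := exists_wordDist_eq p.1 u.1
    have h5 := congrArg List.length h2
    rw [List.length_append] at h5
    rw [h2, h3, List.getElem?_append_left (by omega), List.getElem?_append_left (by omega)]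
  obtain ⟨hu1, hu2⟩ := key u hu
  obtain ⟨hv1, hv2⟩ := key v hv
  rw [List.prefix_iff_getElem?]
  intro z hz
  rcases Nat.lt_or_ge y z with h | h
  · have h1 := u.2 z hz
    have h2 := v.2 z (by omega)
    have h3 := hfree z h (by omega)
    rw [List.getElem?_eq_getElem (by omega)]
    congr 1
    omega
  · rw [hv2 z h, ← hu2 z h, List.getElem?_eq_getElem hz]

theorem wordDist_eq_of_free {y N : ℕ} (hfree : ∀ z, y < z → z < y + 2 * N → s.getD z 0 ≤ 1)
    {p u v : SST s} (hp : p.1.length = y + N) (hu : wordDist p.1 u.1 < N)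
    (hv : wordDist p.1 v.1 < N) :
    dist u v = |(u.1.length : ℝ) - v.1.length| := by
  rcases le_total u.1.length v.1.length with h | h
  · rw [dist_eq, wordDist_of_prefix (prefix_of_free hfree hp hu hv h), Nat.cast_sub h,
      abs_sub_comm, abs_of_nonneg (by simpa using h)]
  · rw [dist_comm, dist_eq, wordDist_of_prefix (prefix_of_free hfree hp hv hu h), Nat.cast_sub h,
      abs_of_nonneg (by simpa using h)]

theorem one_le_dist {u v : SST s} (h : u ≠ v) : 1 ≤ dist u v := by
  have h1 := dist_pos.2 h
  rw [dist_eq] at h1 ⊢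
  exact_mod_cast h1

end SST

theorem getD_binary {k j : ℕ} (h : j < k) : (List.replicate k 2 ++ [0]).getD j 0 = 2 := by
  rw [List.getD_append _ _ _ _ (by simpa using h), List.getD_eq_getElem _ _ (by simpa using h)]
  simp

theorem BinaryTree.length_le {k : ℕ} (v : BinaryTree k) : v.1.length ≤ k := by
  by_contra h
  push Not at h
  have h1 := v.2 k h
  rw [List.getD_append_right _ _ _ _ (by simp)] at h1
  simp at h1

/-- Every ball of radius `2 * q` of a binary tree of depth at least `q` contains `2 ^ q` points. -/
theorem BinaryTree.exists_ball {k q : ℕ} (hq : q ≤ k) (v : BinaryTree k) :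
    ∃ G : (Fin q → Bool) → BinaryTree k, Function.Injective G ∧
      ∀ ε, dist v (G ε) ≤ 2 * q := by
  have hv := v.length_le
  set u := SST.take v (k - q) with hu
  have hul : u.1.length = min (k - q) v.1.length := by simp [hu, SST.take]
  refine ⟨fun ε => ⟨u.1 ++ List.ofFn fun j => (ε j).toNat, fun j hj => ?_⟩, ?_, ?_⟩
  · rcases Nat.lt_or_ge j u.1.length with h | h
    · rw [List.getElem_append_left h]
      exact u.2 j h
    · simp only [List.length_append, List.length_ofFn] at hj
      rw [List.getElem_append_right h, getD_binary (by omega), List.getElem_ofFn]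
      exact Bool.toNat_lt _
  · intro ε ε' h
    have h1 := congrArg Subtype.val h
    simp only [List.append_cancel_left_eq, List.ofFn_inj] at h1
    funext j
    have h2 := congrFun h1 j
    cases h3 : ε j <;> cases h4 : ε' j <;> simp_all
  · intro ε
    refine (dist_triangle v u _).trans ?_
    have hpre : u.1 <+: v.1 := List.take_prefix _ _
    have h1 : dist v u ≤ q := by
      rw [dist_comm, SST.dist_eq, wordDist_of_prefix hpre]
      exact_mod_cast (by omega : v.1.length - u.1.length ≤ q)
    have h2 : ∀ w : BinaryTree k, w.1 = (u.1 ++ List.ofFn fun j => (ε j).toNat) →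
        dist u w ≤ q := by
      intro w hw
      rw [SST.dist_eq, hw, wordDist_of_prefix (List.prefix_append _ _)]
      simp
    refine (add_le_add h1 (h2 _ ?_)).trans_eq (two_mul _).symm
    rfl

theorem card_le_of_separated {ι : Type*} [Fintype ι] (φ : ι → ℝ) (m r : ℝ) (hr : 0 ≤ r)
    (hsep : ∀ a b, a ≠ b → 1 ≤ |φ a - φ b|) (hball : ∀ a, |φ a - m| ≤ r) :
    (Fintype.card ι : ℝ) ≤ 2 * r + 2 := by
  have hinj : Function.Injective fun a => ⌊φ a⌋ := by
    intro a b h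
    by_contra hne
    exact absurd (Int.abs_sub_lt_one_of_floor_eq_floor h) (not_lt.2 (hsep a b hne))
  have h1 : (Finset.univ.image fun a => ⌊φ a⌋) ⊆ Finset.Icc ⌊m - r⌋ ⌊m + r⌋ := by
    intro z hz
    obtain ⟨a, -, rfl⟩ := Finset.mem_image.1 hz
    have := abs_le.1 (hball a)
    rw [Finset.mem_Icc]
    exact ⟨Int.floor_le_floor (by linarith), Int.floor_le_floor (by linarith)⟩
  have h2 := Finset.card_le_card h1
  rw [Finset.card_image_of_injective _ hinj, Finset.card_univ, Int.card_Icc] at h2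
  have h3 : ⌊m - r⌋ ≤ ⌊m + r⌋ := Int.floor_le_floor (by linarith)
  have h4 : (Fintype.card ι : ℤ) ≤ ⌊m + r⌋ + 1 - ⌊m - r⌋ := by omega
  have h5 : (Fintype.card ι : ℝ) ≤ ⌊m + r⌋ + 1 - ⌊m - r⌋ := by exact_mod_cast h4
  have h6 := Int.floor_le (m + r)
  have h7 := Int.lt_floor_add_one (m - r)
  linarith

/-- Fixes the radius parameter q at which a ball with 2^q points no longer fits into a path with
distortion c. -/
theorem exists_two_pow_gt (c : ℝ) : ∃ q : ℕ, 2 * (c * (2 * q + 1)) + 2 < 2 ^ q := by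
  obtain ⟨n, hn⟩ := exists_nat_ge (8 * |c| + 4)
  refine ⟨2 * n, ?_⟩
  have h1 : (n : ℝ) + 1 ≤ 2 ^ n := by exact_mod_cast (Nat.lt_two_pow_self (n := n))
  have h2 : (2 : ℝ) ^ (2 * n) = 2 ^ n * 2 ^ n := by rw [two_mul, pow_add]
  have hn0 : (0 : ℝ) ≤ n := Nat.cast_nonneg n
  have h3 : c * (2 * (2 * n) + 1) ≤ |c| * (2 * (2 * n) + 1) :=
    mul_le_mul_of_nonneg_right (le_abs_self c) (by positivity)
  have h4 : ((n : ℝ) + 1) * (n + 1) ≤ 2 ^ n * 2 ^ n := by gcongr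
  rw [h2]
  push_cast
  nlinarith [abs_nonneg c, mul_nonneg (abs_nonneg c) hn0]

/-- A vertical segment between image points of a connected set is close to the image. -/
theorem exists_near_image {k i : ℕ} {A : ℝ} {f : BinaryTree k → Cantor i}
    (hA : ∀ x y, dist (f x) (f y) ≤ A * dist x y) {v₀ w₀ : BinaryTree k} {p : Cantor i}
    (hv : p.1 <+: (f v₀).1) (hw : ¬ p.1 <+: (f w₀).1) : ∃ v, dist p (f v) ≤ A := by
  by_contra! hcon
  -- If an edge had images on both sides of p, the path between them, of length at most A, would
  -- contain p.
  have inv : ∀ v w : BinaryTree k, (SST.graph _).Walk v w → p.1 <+: (f v).1 → p.1 <+: (f w).1 := by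
    intro v w W
    induction W with
    | nil => exact id
    | cons hadj W ih =>
      rename_i x y z
      intro hx
      refine ih ?_
      by_contra hy
      have h1 : dist x y = 1 := by
        have : (SST.graph (List.replicate k 2 ++ [0])).dist x y = 1 :=
          SimpleGraph.dist_eq_one_iff_adj.2 hadj
        rw [SST.dist_eq, ← SST.graph_dist_eq, this, Nat.cast_one]
      have h2 := hA x y
      rw [h1, mul_one] at h2
      refine absurd (hcon x) (not_lt.2 (le_trans ?_ h2))
      rw [SST.dist_eq, SST.dist_eq, wordDist_of_prefix hx]
      exact_mod_cast length_sub_le_wordDist hx hy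
  obtain ⟨W⟩ := (SST.connected (List.replicate k 2 ++ [0])).preconnected v₀ w₀
  exact hw (inv v₀ w₀ W hv)

/-- A longer leg contains a branching-free stretch of length 2·2^j with midpoint p. Some image point
is within A of p, so the ball of radius 2q around its preimage lands within A(2q + 1) < 2^j of p,
where the tree is a path. Its 2^q points then have depths that, scaled by B, are 1-separated in an
interval of radius c(2q + 1), against the choice of q. -/
theorem vertical_length_lt {k i q j n : ℕ} {A B c : ℝ} (hA0 : 0 ≤ A) (hB0 : 0 < B)
    (hAB : A * B ≤ c) (hqk : q ≤ k) (hq : 2 * (c * (2 * q + 1)) + 2 < 2 ^ q)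
    {f : BinaryTree k → Cantor i}
    (hA : ∀ x y, dist (f x) (f y) ≤ A * dist x y) (hB : ∀ x y, dist x y ≤ B * dist (f x) (f y))
    (hj : A * (2 * q + 1) < 2 ^ j) {v₀ w₀ : BinaryTree k} {w x y : List ℕ}
    (hv : (f v₀).1 = w ++ x) (hw : (f w₀).1 = w ++ y)
    (hd : wordDist (f v₀).1 (f w₀).1 = x.length + y.length) (hn : x.length = n) :
    n < height (j + 1) + 2 * 2 ^ (j + 1) := by
  by_contra! hcon
  have hlen := (f v₀).length_le
  have hlen' : (f v₀).1.length = w.length + n := by rw [hv, List.length_append, hn]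
  obtain ⟨y₀, h1, h2, h3⟩ := exists_free_interval (i := i) (j := j + 1) (a := w.length)
    (b := w.length + n) (by omega) (by omega)
  rw [pow_succ'] at h2 h3
  have hjpos := Nat.two_pow_pos j
  set p : Cantor i := SST.take (f v₀) (y₀ + 2 ^ j) with hp
  have hpl : p.1.length = y₀ + 2 ^ j := by simp [hp, SST.take]; omega
  have hpv : p.1 <+: (f v₀).1 := List.take_prefix _ _
  have hpw : ¬ p.1 <+: (f w₀).1 := by
    intro hpw
    obtain ⟨α, hα⟩ := hpv
    obtain ⟨β, hβ⟩ := hpw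
    rw [← hα, ← hβ, wordDist_append_append] at hd
    have h5 := wordDist_le_add α β
    have h6 := congrArg List.length (hα.trans hv)
    have h7 := congrArg List.length (hβ.trans hw)
    simp only [List.length_append] at h6 h7
    omega
  obtain ⟨v, hvp⟩ := exists_near_image hA hpv hpw
  obtain ⟨G, hG, hGd⟩ := BinaryTree.exists_ball hqk v
  have hclose : ∀ ε, dist p (f (G ε)) ≤ A * (2 * q + 1) := fun ε => by
    have h5 := dist_triangle p (f v) (f (G ε))
    have h6 := hA v (G ε)
    have h7 := mul_le_mul_of_nonneg_left (hGd ε) hA0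
    linarith
  have hclose' : ∀ ε, wordDist p.1 (f (G ε)).1 < 2 ^ j := fun ε => by
    have h5 := (hclose ε).trans_lt hj
    rw [SST.dist_eq] at h5
    exact_mod_cast h5
  have hcount := card_le_of_separated (fun ε => B * ((f (G ε)).1.length : ℝ)) (B * p.1.length)
    (B * (A * (2 * q + 1))) (by positivity) (fun ε ε' hne => by
      rw [← mul_sub, abs_mul, abs_of_pos hB0,
        ← SST.wordDist_eq_of_free h3 hpl (hclose' ε) (hclose' ε')]
      exact (SST.one_le_dist (hG.ne hne)).trans (hB _ _)) (fun ε => by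
      rw [← mul_sub, abs_mul, abs_of_pos hB0]
      refine mul_le_mul_of_nonneg_left (le_trans ?_ (hclose ε)) hB0.le
      rw [SST.dist_eq]
      have h5 := length_add_le_of_wordDist (l := p.1) (l' := (f (G ε)).1)
      have h6 : (p.1.length : ℝ) ≤ (f (G ε)).1.length + wordDist p.1 (f (G ε)).1 := by
        exact_mod_cast h5.1
      have h7 : ((f (G ε)).1.length : ℝ) ≤ p.1.length + wordDist p.1 (f (G ε)).1 := by
        exact_mod_cast h5.2
      rw [abs_le]
      constructor <;> linarith)
  simp only [Fintype.card_pi, Fintype.card_bool, Finset.prod_const, Finset.card_univ,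
    Fintype.card_fin] at hcount
  push_cast at hcount
  have h5 : B * (A * (2 * q + 1)) ≤ c * (2 * q + 1) := by
    rw [← mul_assoc, mul_comm B]
    exact mul_le_mul_of_nonneg_right hAB (by positivity)
  linarith

/-- The root and a leaf of B_k are at distance k, and the longer leg n between their images is
bounded at a scale 2^j comparable to A. Multiplying by B recovers AB ≤ c, so the scale of f drops
out. -/
theorem depth_le_of_biLipschitz {k i q : ℕ} {A B c : ℝ} (hB0 : 0 < B) (hAB : A * B ≤ c)
    (hc : 0 ≤ c)
    (hk : 0 < k) (hqk : q ≤ k) (hq : 2 * (c * (2 * q + 1)) + 2 < 2 ^ q)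
    {f : BinaryTree k → Cantor i} (hf : Function.Injective f)
    (hA : ∀ x y, dist (f x) (f y) ≤ A * dist x y)
    (hB : ∀ x y, dist x y ≤ B * dist (f x) (f y)) :
    (k : ℝ) ≤ 40 * c * (q + 1) * i := by
  set r : BinaryTree k := SST.root _ with hr
  set l : ℕ → BinaryTree k := fun n => ⟨List.replicate (min n k) 0, fun j hj => by
    simp only [List.length_replicate] at hj
    rw [getD_binary (by omega)]; simp⟩ with hl
  have hdl : ∀ n ≤ k, dist r (l n) = n := fun n hn => by
    rw [SST.dist_eq, hr, hl, SST.root]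
    simp [wordDist, hn]
  -- Distinct image points have distance at least one.
  have hA1 : 1 ≤ A := by
    have h1 : r ≠ l 1 := fun h => by
      have := hdl 1 hk
      rw [← h, dist_self] at this
      norm_num at this
    have h2 := (SST.one_le_dist (hf.ne h1)).trans (hA _ _)
    rwa [hdl 1 hk, Nat.cast_one, mul_one] at h2
  obtain ⟨j, hj1, hj2⟩ : ∃ j : ℕ, A * (2 * q + 1) < 2 ^ j ∧ (2 : ℝ) ^ j ≤ 2 * (A * (2 * q + 1)) := by
    have hρ : 1 ≤ A * (2 * q + 1) := by nlinarith [(Nat.cast_nonneg q : (0 : ℝ) ≤ q)]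
    obtain ⟨n, h1, h2⟩ := exists_nat_pow_near hρ (by norm_num : (1 : ℝ) < 2)
    exact ⟨n + 1, h2, by rw [pow_succ']; linarith⟩
  obtain ⟨n, hn1, hn2, hn3⟩ : ∃ n : ℕ, n < height (j + 1) + 2 * 2 ^ (j + 1) ∧ n ≤ height i ∧
      dist (f r) (f (l k)) ≤ 2 * n := by
    obtain ⟨w, x, y, h1, h2, h3⟩ := exists_wordDist_eq (f r).1 (f (l k)).1
    have h4 := (f r).length_le
    have h5 := (f (l k)).length_le
    rw [h1, List.length_append] at h4
    rw [h2, List.length_append] at h5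
    rcases le_total y.length x.length with h | h
    · refine ⟨x.length, vertical_length_lt (by linarith) hB0 hAB hqk hq hA hB hj1 h1 h2 h3 rfl,
        by omega, ?_⟩
      rw [SST.dist_eq, h3]
      exact_mod_cast (by omega : x.length + y.length ≤ 2 * x.length)
    · refine ⟨y.length, vertical_length_lt (by linarith) hB0 hAB hqk hq hA hB hj1 h2 h1 ?_ rfl,
        by omega, ?_⟩
      · rw [← SST.graph_dist_eq, SimpleGraph.dist_comm, SST.graph_dist_eq, h3, add_comm]
      · rw [SST.dist_eq, h3]
        exact_mod_cast (by omega : x.length + y.length ≤ 2 * y.length)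
  have hkB : (k : ℝ) ≤ B * (2 * n) := by
    have h1 := hB r (l k)
    rw [hdl k le_rfl] at h1
    exact h1.trans (mul_le_mul_of_nonneg_left hn3 hB0.le)
  -- For small i the height of C_i bounds n. Otherwise j + 1 < i, and twice the leg bound is (j +
  -- 5)·2^(j+1) with j + 5 ≤ 5i.
  have hn4 : 2 * n ≤ 5 * i * 2 ^ (j + 1) := by
    rcases le_or_gt i (j + 1) with h | h
    · have h1 := two_mul_height i
      have h2 : i * 2 ^ i ≤ i * 2 ^ (j + 1) :=
        Nat.mul_le_mul_left _ (Nat.pow_le_pow_right (by norm_num) h)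
      nlinarith
    · have h1 := two_mul_height (j + 1)
      have h2 : (j + 1 + 4) * 2 ^ (j + 1) ≤ (5 * i) * 2 ^ (j + 1) :=
        Nat.mul_le_mul_right _ (by omega)
      nlinarith
  have hn5 : (2 : ℝ) * n ≤ 5 * i * 2 ^ (j + 1) := by exact_mod_cast hn4
  have hi0 : (0 : ℝ) ≤ i := Nat.cast_nonneg i
  have hq0 : (0 : ℝ) ≤ q := Nat.cast_nonneg q
  calc (k : ℝ) ≤ B * (2 * n) := hkB
    _ ≤ B * (5 * i * (2 * (2 * (A * (2 * q + 1))))) := by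
        refine mul_le_mul_of_nonneg_left (hn5.trans ?_) hB0.le
        rw [pow_succ']
        gcongr
    _ = (A * B) * (20 * i * (2 * q + 1)) := by ring
    _ ≤ c * (20 * i * (2 * q + 1)) := mul_le_mul_of_nonneg_right hAB (by positivity)
    _ ≤ _ := by nlinarith [mul_nonneg hc hi0]

theorem binaryDepth_cantor_le {c : ℝ} (hc : 1 < c) :
    ∃ K : ℕ, ∀ i : ℕ, binaryDepth (Cantor i) c ≤ ((K * i : ℕ) : ℕ∞) := by
  obtain ⟨q, hq⟩ := exists_two_pow_gt c
  obtain ⟨M, hM⟩ := exists_nat_ge (40 * c * (q + 1))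
  refine ⟨M + q, fun i => iSup₂_le fun k hk => ?_⟩
  rw [Nat.cast_le]
  rw [distortion] at hk
  simp only [iInf_lt_iff] at hk
  obtain ⟨f, hf, hfc⟩ := hk
  rcases Nat.eq_zero_or_pos k with rfl | hk0
  · exact Nat.zero_le _
  have hnt : Nontrivial (BinaryTree k) := by
    refine ⟨SST.root _, SST.snoc (SST.root _) 0 ?_, fun h => ?_⟩
    · rw [SST.root, List.length_nil, getD_binary hk0]; norm_num
    · simpa [SST.root, SST.snoc] using congrArg Subtype.val h
  obtain ⟨A, B, hAB, hB0, hA, hB⟩ := edist_le_of_mapDistortion hf (ne_top_of_lt hfc)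
  have hi : 0 < i := by
    rcases Nat.eq_zero_or_pos i with rfl | hi
    · have hsub : Subsingleton (Cantor 0) := ⟨fun u v => Subtype.ext (by
        have h1 := u.length_le
        have h2 := v.length_le
        rw [height, Nat.le_zero, List.length_eq_zero_iff] at h1 h2
        rw [h1, h2])⟩
      obtain ⟨x, y, hxy⟩ := exists_pair_ne (BinaryTree k)
      exact absurd (hf (Subsingleton.elim _ _)) hxy
    · exact hi
  -- Depths below q are covered by the summand q of the constant, since i ≥ 1.
  rcases Nat.lt_or_ge k q with hkq | hkq
  · nlinarith
  have hA' : ∀ x y, dist (f x) (f y) ≤ A * dist x y := fun x y => by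
    have := hA x y
    rw [edist_nndist, edist_nndist] at this
    exact_mod_cast this
  have hB' : ∀ x y, dist x y ≤ B * dist (f x) (f y) := fun x y => by
    have := hB x y
    rw [edist_nndist, edist_nndist] at this
    exact_mod_cast this
  have hABc : (A : ℝ) * B ≤ c := by
    rw [← hAB, ← ENNReal.coe_mul] at hfc
    have h1 := (ENNReal.toReal_le_of_le_ofReal (by linarith) hfc.le)
    simpa using h1
  have h := depth_le_of_biLipschitz (by exact_mod_cast hB0) hABc (by linarith) hk0 hkq hq hf hA' hB'
  have h2 : (k : ℝ) ≤ M * i := h.trans (mul_le_mul_of_nonneg_right hM (Nat.cast_nonneg i))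
  have h3 : k ≤ M * i := by exact_mod_cast h2
  nlinarith

/-! ### Weak prototypes -/

/-- The differences of consecutive elements of a list. -/
def gaps (l : List ℕ) : List ℝ := List.zipWith (fun a b : ℕ => (b : ℝ) - a) l l.tail

theorem gaps_append_cons (l l' : List ℕ) (a b : ℕ) :
    gaps (l ++ [a] ++ b :: l') = gaps (l ++ [a]) ++ ((b : ℝ) - a) :: gaps (b :: l') := by
  induction l with
  | nil => simp [gaps]
  | cons c l ih =>
    cases l with
    | nil => simp [gaps]
    | cons d l => simpa [gaps] using ih

theorem gaps_map_add (l : List ℕ) (n : ℕ) : gaps (l.map (n + ·)) = gaps l := by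
  rw [gaps, gaps, ← List.map_tail, List.zipWith_map]
  congr 1
  funext a b
  push_cast
  ring

/-- The positions of the entries of a degree sequence that are at least two. -/
def branchLevels (s : List ℕ) : List ℕ := (List.range s.length).filter fun j => 2 ≤ s.getD j 0

theorem branchLevels_append (s s' : List ℕ) :
    branchLevels (s ++ s') = branchLevels s ++ (branchLevels s').map (s.length + ·) := by
  rw [branchLevels, List.length_append, List.range_add, List.filter_append]
  congr 1
  · refine List.filter_congr fun j hj => ?_
    rw [List.getD_append _ _ _ _ (List.mem_range.1 hj)]
  · rw [List.filter_map, branchLevels]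
    congr 1
    refine List.filter_congr fun j _ => ?_
    simp [List.getElem?_append_right]

theorem branchLevels_replicate_one (n : ℕ) : branchLevels (List.replicate n 1) = [] := by
  rw [branchLevels, List.filter_eq_nil_iff]
  intro j hj
  simp only [List.length_replicate, List.mem_range] at hj
  rw [List.getD_eq_getElem _ _ (by simpa using hj)]
  simp

theorem branchLevels_cantorSeq_succ (i : ℕ) : branchLevels (cantorSeq (i + 1)) =
    branchLevels (cantorSeq i) ++ (branchLevels (cantorSeq i)).map (height i + 2 ^ i + ·) := by
  have := Nat.two_pow_pos i
  rw [cantorSeq, branchLevels_append, branchLevels_append, branchLevels_replicate_one]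
  simp only [List.map_nil, List.append_nil, List.length_append, List.length_replicate,
    length_cantorSeq]
  rw [show height i + 1 + (2 ^ i - 1) = height i + 2 ^ i by omega]

theorem branchLevels_cantorSeq_eq (i : ℕ) : ∃ l l', branchLevels (cantorSeq i) = 0 :: l ∧
    branchLevels (cantorSeq i) = l' ++ [height i] := by
  induction i with
  | zero =>
    exact ⟨[], [], by simp [branchLevels, cantorSeq], by simp [branchLevels, cantorSeq, height]⟩
  | succ i ih =>
    obtain ⟨l, l', h1, h2⟩ := ih
    refine ⟨_, branchLevels (cantorSeq i) ++ l'.map (height i + 2 ^ i + ·), by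
      rw [branchLevels_cantorSeq_succ]; nth_rw 1 [h1]; rw [List.cons_append], ?_⟩
    rw [branchLevels_cantorSeq_succ]
    nth_rw 2 [h2]
    rw [List.map_append, List.append_assoc, List.map_singleton]
    congr 3
    rw [height]; ring

theorem gaps_cantorSeq_succ (i : ℕ) : gaps (branchLevels (cantorSeq (i + 1))) =
    gaps (branchLevels (cantorSeq i)) ++ (2 ^ i : ℝ) :: gaps (branchLevels (cantorSeq i)) := by
  obtain ⟨l, l', h1, h2⟩ := branchLevels_cantorSeq_eq i
  have h3 := gaps_map_add (branchLevels (cantorSeq i)) (height i + 2 ^ i)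
  rw [branchLevels_cantorSeq_succ]
  rw [h1, List.map_cons] at h3
  nth_rw 2 [h1]
  rw [List.map_cons, h2, gaps_append_cons, ← h2, h3, ← h1]
  congr 2
  push_cast
  ring

theorem sum_gaps_cantorSeq (i : ℕ) :
    (gaps (branchLevels (cantorSeq i))).sum = height i := by
  induction i with
  | zero => simp [branchLevels, cantorSeq, height, gaps]
  | succ i ih =>
    rw [gaps_cantorSeq_succ, List.sum_append, List.sum_cons, ih, height]
    push_cast
    ring

/-- Each m < i contributes gaps 2^m of total length 2^(i-1), and the threshold θ admits at least
those with m ≤ n. -/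
theorem le_sum_filter_gaps {n : ℕ} {θ : ℝ} (hθ : (2 : ℝ) ^ n ≤ θ) (i : ℕ) :
    (min i (n + 1) : ℕ) * (2 : ℝ) ^ i ≤
      2 * ((gaps (branchLevels (cantorSeq i))).filter fun x => x ≤ θ).sum := by
  induction i with
  | zero => simp [branchLevels, cantorSeq, gaps]
  | succ i ih =>
    rw [gaps_cantorSeq_succ, List.filter_append, List.sum_append, List.filter_cons]
    have hp : (0 : ℝ) < 2 ^ i := by positivity
    rcases Nat.lt_or_ge n i with h | h
    · rw [min_eq_right (by omega)] at ih
      rw [min_eq_right (by omega), pow_succ]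
      split_ifs
      · rw [List.sum_cons]; nlinarith
      · nlinarith
    · rw [min_eq_left (by omega)] at ih
      have h1 : (2 : ℝ) ^ i ≤ θ := (pow_le_pow_right₀ (by norm_num) h).trans hθ
      rw [min_eq_left (by omega), if_pos (by simpa using h1), List.sum_cons, pow_succ]
      push_cast
      nlinarith

theorem isWeakPath_cantor {i : ℕ} (hi : 2 ≤ i) :
    IsWeakPath (1 / 2) ((2 : ℝ) ^ (-(i : ℝ) / 3)) (0 :: gaps (branchLevels (cantorSeq i))) := by
  set δ := (2 : ℝ) ^ (-(i : ℝ) / 3) with hδ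
  have hsum : (0 :: gaps (branchLevels (cantorSeq i))).sum = (height i : ℝ) := by
    rw [List.sum_cons, zero_add, sum_gaps_cantorSeq]
  have hh : 2 * (height i : ℝ) = i * 2 ^ i := by exact_mod_cast two_mul_height i
  have hi' : (2 : ℝ) ≤ i := by exact_mod_cast hi
  -- With n = ⌊i/2⌋ at least half of the scales are admitted, while 2^n ≤ 2^(2i/3) ≤ δ·height; the
  -- bound 2^i ≤ height needs i ≥ 2.
  obtain ⟨n, hn1, hn2⟩ : ∃ n : ℕ, i ≤ 2 * (n + 1) ∧ 2 * n ≤ i := ⟨i / 2, by omega, by omega⟩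
  have hθ : (2 : ℝ) ^ n ≤ δ * height i := by
    have h1 : (2 : ℝ) ^ i ≤ height i := by
      have : (0 : ℝ) < 2 ^ i := by positivity
      nlinarith
    have hn2' : (2 : ℝ) * n ≤ i := by exact_mod_cast hn2
    calc (2 : ℝ) ^ n = 2 ^ (n : ℝ) := (Real.rpow_natCast 2 n).symm
      _ ≤ 2 ^ (-(i : ℝ) / 3 + i) := Real.rpow_le_rpow_of_exponent_le (by norm_num) (by linarith)
      _ = δ * 2 ^ i := by rw [Real.rpow_add (by norm_num), Real.rpow_natCast]
      _ ≤ δ * height i := mul_le_mul_of_nonneg_left h1 (by positivity)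
  have hδ0 : 0 ≤ δ * height i := by positivity
  rw [IsWeakPath, hsum, List.filter_cons, if_pos (by simpa using hδ0), List.sum_cons, zero_add]
  have h2 := le_sum_filter_gaps hθ i
  have h3 : (i : ℝ) ≤ 2 * (min i (n + 1) : ℕ) := by
    exact_mod_cast (by omega : i ≤ 2 * min i (n + 1))
  have hp : (0 : ℝ) < 2 ^ i := by positivity
  nlinarith

theorem pathDist_one {V : Type*} {G : SimpleGraph V} (hG : G.Connected) (u v : V) :
    pathDist G (fun _ => 1) u v = G.dist u v := by
  have h : ∀ w : G.Walk u v, (w.edges.map fun _ => (1 : ℝ)).sum = w.length := fun w => by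
    simp
  simp only [pathDist, h]
  obtain ⟨w, hw⟩ := hG.exists_walk_length_eq_dist u v
  have : Nonempty (G.Walk u v) := ⟨w⟩
  refine le_antisymm ((ciInf_le ⟨0, ?_⟩ w).trans_eq (by rw [hw])) (le_ciInf fun w' => ?_)
  · rintro _ ⟨w', rfl⟩
    positivity
  · exact_mod_cast SimpleGraph.dist_le w'

namespace SST

variable {s : List ℕ}

theorem take_of_length_le {v : SST s} {n : ℕ} (h : v.1.length ≤ n) : v.take n = v :=
  Subtype.ext (List.take_of_length_le h)

theorem take_take {v : SST s} {m n : ℕ} (h : m ≤ n) : (v.take n).take m = v.take m :=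
  Subtype.ext (by simp [take, List.take_take, h])

theorem exists_path (v : SST s) (n : ℕ) (hn : v.1.length = n) :
    ∃ P : (graph s).Walk (root s) v, P.IsPath ∧ P.support = (List.range (n + 1)).map v.take := by
  induction n generalizing v with
  | zero =>
    have hv : v = root s := Subtype.ext (List.length_eq_zero_iff.1 hn)
    subst hv
    exact ⟨SimpleGraph.Walk.nil, SimpleGraph.Walk.IsPath.nil, by
      simp [take_of_length_le, hn]⟩
  | succ n ih =>
    have hl : (v.take n).1.length = n := by simp [take]; omega
    obtain ⟨P, hP, hs⟩ := ih (v.take n) hl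
    have hadj : (graph s).Adj (v.take n) v := by
      refine Or.inl ⟨v.1[n], ?_⟩
      simp only [take]
      rw [List.take_append_getElem, List.take_of_length_le (by omega)]
    have hs' : P.support = (List.range (n + 1)).map v.take := by
      rw [hs]
      refine List.map_congr_left fun m hm => take_take ?_
      have := List.mem_range.1 hm
      omega
    refine ⟨P.concat hadj, hP.concat ?_ hadj, ?_⟩
    · rw [hs', List.mem_map]
      rintro ⟨m, hm, h⟩
      have h1 := congrArg (fun u => u.1.length) h
      simp only [take, List.length_take, List.mem_range] at h1 hm
      omega
    · rw [SimpleGraph.Walk.support_concat, hs', List.range_succ (n := n + 1), List.map_append,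
        List.map_singleton, take_of_length_le hn.le]

theorem zipWith_pathDist_take (v : SST s) (l : List ℕ) (hl : l.Pairwise (· ≤ ·))
    (hv : ∀ n ∈ l, n ≤ v.1.length) :
    List.zipWith (pathDist (graph s) fun _ => 1) (l.map v.take) (l.map v.take).tail = gaps l := by
  have key : ∀ m n, m ≤ n → n ≤ v.1.length →
      pathDist (graph s) (fun _ => 1) (v.take m) (v.take n) = (n : ℝ) - m := by
    intro m n hmn hn
    have hpre : (v.take m).1 <+: (v.take n).1 := by
      simp only [take]
      exact List.take_prefix_take_left hmn
    rw [pathDist_one (connected s), graph_dist_eq, wordDist_of_prefix hpre]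
    simp only [take, List.length_take]
    rw [min_eq_left hn, min_eq_left (hmn.trans hn), Nat.cast_sub hmn]
  induction l with
  | nil => simp [gaps]
  | cons a l ih =>
    cases l with
    | nil => simp [gaps]
    | cons b l =>
      have hab : a ≤ b := (List.pairwise_cons.1 hl).1 b (by simp)
      have := ih (List.pairwise_cons.1 hl).2 fun n hn => hv n (by simp [hn])
      simp only [List.map_cons, List.tail_cons, List.zipWith_cons_cons, gaps] at this ⊢
      rw [key a b hab (hv b (by simp)), this]

end SST

theorem Cantor.length_of_isLeaf {i : ℕ} {v : Cantor i}
    (hv : IsLeaf (SST.graph (cantorDegrees i)) (SST.root (cantorDegrees i)) v) :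
    v.1.length = height i := by
  rw [SST.isLeaf_iff] at hv
  refine le_antisymm (Cantor.length_le v) (not_lt.1 fun h => ?_)
  have := getD_cantorDegrees_pos_iff.2 h
  omega

theorem isWeakPrototype_cantor {i : ℕ} (hi : 2 ≤ i) :
    IsWeakPrototype (SST.graph (cantorDegrees i)) (SST.root (cantorDegrees i)) (fun _ => 1)
      (1 / 2) ((2 : ℝ) ^ (-(i : ℝ) / 3)) 1 where
  isTree := SST.isTree
  length_pos _ _ := one_pos
  one_or_two_children v hv := by
    rw [SST.isLeaf_iff, ← ne_eq, ← Nat.pos_iff_ne_zero, getD_cantorDegrees_pos_iff] at hv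
    rw [SST.encard_children, getD_cantorDegrees_of_lt hv]
    exact (getD_cantorSeq_eq_one_or_two hv.le).imp (fun h => by rw [h]; rfl)
      fun h => by rw [h]; rfl
  root_leaf_weak v P hv hP := by
    classical
    have hlen := Cantor.length_of_isLeaf hv
    obtain ⟨Q, hQ, hQs⟩ := SST.exists_path v _ hlen
    have hPQ : P = Q := congrArg Subtype.val
      ((SST.isAcyclic.subsingleton_path _ _).elim ⟨P, hP⟩ ⟨Q, hQ⟩)
    have hfilter : P.support.filter (fun x => 2 ≤ (children (SST.graph (cantorDegrees i))
        (SST.root (cantorDegrees i)) x).encard) ++ [v] =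
        (branchLevels (cantorSeq i)).map v.take := by
      have h1 : (List.range (height i + 1)).filter (fun j => decide (2 ≤ (children
          (SST.graph (cantorDegrees i)) (SST.root (cantorDegrees i)) (v.take j)).encard)) =
          (List.range (height i)).filter fun j => decide (2 ≤ (cantorSeq i).getD j 0) := by
        rw [List.range_succ, List.filter_append]
        have h2 : ¬ (2 : ℕ∞) ≤ (children (SST.graph (cantorDegrees i))
            (SST.root (cantorDegrees i)) (v.take (height i))).encard := by
          rw [SST.take_of_length_le hlen.le, SST.encard_children, hlen,
            getD_cantorDegrees_of_ge le_rfl]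
          norm_num
        rw [List.filter_cons_of_neg (by simpa using h2), List.filter_nil, List.append_nil]
        refine List.filter_congr fun j hj => ?_
        have hj' := List.mem_range.1 hj
        have hjl : (v.take j).1.length = j := by simp [SST.take]; omega
        rw [SST.encard_children, hjl, getD_cantorDegrees_of_lt hj', decide_eq_decide]
        exact_mod_cast Iff.rfl
      rw [hPQ, hQs, List.filter_map]
      -- The last entry 2 of S_i, which is 0 in the tree, accounts for the leaf that ends the list.
      have h3 : branchLevels (cantorSeq i) =
          ((List.range (height i)).filter fun j => decide (2 ≤ (cantorSeq i).getD j 0)) ++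
            [height i] := by
        rw [branchLevels, length_cantorSeq, List.range_succ, List.filter_append,
          List.filter_cons_of_pos (by rw [getD_cantorSeq_height]; simp), List.filter_nil]
      rw [h3, List.map_append, List.map_singleton, SST.take_of_length_le hlen.le, ← h1]
      rfl
    have hroot : v.take 0 = SST.root (cantorDegrees i) := Subtype.ext (by simp [SST.take, SST.root])
    have hbranch : branchList (SST.graph (cantorDegrees i)) (SST.root (cantorDegrees i)) P =
        (0 :: branchLevels (cantorSeq i)).map v.take := by
      rw [branchList, List.cons_append, List.map_cons, hroot, ← hfilter]
    have hsorted : (0 :: branchLevels (cantorSeq i)).Pairwise (· ≤ ·) := by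
      refine List.pairwise_cons.2 ⟨fun _ _ => Nat.zero_le _, ?_⟩
      exact (List.pairwise_le_range).filter _
    have hbound : ∀ n ∈ 0 :: branchLevels (cantorSeq i), n ≤ v.1.length := by
      intro n hn
      rcases List.mem_cons.1 hn with rfl | hn
      · exact Nat.zero_le _
      · rw [branchLevels, List.mem_filter, List.mem_range, length_cantorSeq] at hn
        omega
    rw [IsDegreeTwoWeak, hbranch, SST.zipWith_pathDist_take v _ hsorted hbound]
    obtain ⟨l, l', h1, -⟩ := branchLevels_cantorSeq_eq i
    -- The root occurs twice, as the start of the path and as a branching vertex, so the first gap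
    -- is 0.
    have : gaps (0 :: branchLevels (cantorSeq i)) = 0 :: gaps (branchLevels (cantorSeq i)) := by
      rw [h1]; simp [gaps]
    rw [this]
    exact isWeakPath_cantor hi
  height_ratio v w hv hw := by
    rw [one_mul, pathDist_one (SST.connected _), pathDist_one (SST.connected _),
      SST.graph_dist_root, SST.graph_dist_root, Cantor.length_of_isLeaf hv,
      Cantor.length_of_isLeaf hw]

/-! ### Distortion and binary depth -/

theorem min_one_div_eq {p : ℝ} (hp : 1 < p) : min (1 / p) (1 / 2) = 1 / max 2 p := by
  rcases le_total 2 p with h | h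
  · rw [max_eq_right h, min_eq_left (one_div_le_one_div_of_le (by norm_num) h)]
  · rw [max_eq_left h, min_eq_right (one_div_le_one_div_of_le (by linarith) h)]

theorem binaryDepth_cantor_le_mul {c : ℝ} (hc : 1 < c) : ∃ K : ℝ≥0, ∀ i : ℕ,
    (binaryDepth (Cantor i) c : ℝ≥0∞) ≤ (K : ℝ≥0∞) * i := by
  obtain ⟨K, hK⟩ := binaryDepth_cantor_le hc
  refine ⟨K, fun i => ?_⟩
  have h := ENat.toENNReal_le.2 (hK i)
  rw [ENat.toENNReal_coe] at h
  refine h.trans_eq ?_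
  push_cast
  rfl

/-- Both sides are compared with i. Since κ ≤ 1 and the exponent is at most 1, κ is at most its own
power, which makes κ independent of p. -/
theorem binaryDepth_rpow_le_markovConvexity {c : ℝ} (hc : 1 < c) : ∃ κ : ℝ≥0, 0 < κ ∧
    ∀ p : ℝ, 1 < p → ∀ i : ℕ,
      (κ : ℝ≥0∞) * (binaryDepth (Cantor i) c : ℝ≥0∞) ^ (min (1 / p) (1 / 2)) ≤
        markovConvexity (max 2 p) (Cantor i) := by
  obtain ⟨K, hK⟩ := binaryDepth_cantor_le_mul hc
  set κ : ℝ≥0 := 1 / (8 * (K + 1)) with hκ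
  have hκ0 : 0 < κ := by positivity
  have hκ1 : κ ≤ 1 := by
    rw [hκ, div_le_one (by positivity)]
    exact (by norm_num : (1 : ℝ≥0) ≤ 8 * 1).trans
      (mul_le_mul_of_nonneg_left (by simp) (by norm_num))
  have hκK : κ * K ≤ 1 / 8 := by
    rw [hκ, div_mul_eq_mul_div, one_mul, div_le_div_iff₀ (by positivity) (by norm_num), one_mul,
      mul_comm]
    exact mul_le_mul_of_nonneg_left (by simp) (by norm_num)
  refine ⟨κ, hκ0, fun p hp i => ?_⟩
  have hq : (0 : ℝ) < max 2 p := lt_max_of_lt_left (by norm_num)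
  rw [min_one_div_eq hp]
  set θ := 1 / max 2 p with hθ
  have hθ0 : 0 ≤ θ := by positivity
  have hθ1 : θ ≤ 1 := by
    rw [hθ, div_le_one hq]
    exact le_max_of_le_left (by norm_num)
  have hle : (κ : ℝ≥0∞) ≤ (κ : ℝ≥0∞) ^ θ := by
    nth_rw 1 [← ENNReal.rpow_one (κ : ℝ≥0∞)]
    exact ENNReal.rpow_le_rpow_of_exponent_ge (by exact_mod_cast hκ1) hθ1
  calc _ ≤ (κ : ℝ≥0∞) ^ θ * (binaryDepth (Cantor i) c : ℝ≥0∞) ^ θ := by gcongr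
    _ = ((κ : ℝ≥0∞) * (binaryDepth (Cantor i) c : ℝ≥0∞)) ^ θ :=
        (ENNReal.mul_rpow_of_nonneg _ _ hθ0).symm
    _ ≤ (((1 / 8 : ℝ≥0) : ℝ≥0∞) * i) ^ θ := by
        refine ENNReal.rpow_le_rpow ?_ hθ0
        calc _ ≤ (κ : ℝ≥0∞) * ((K : ℝ≥0∞) * i) := by gcongr; exact hK i
          _ = ((κ * K : ℝ≥0) : ℝ≥0∞) * i := by push_cast; ring
          _ ≤ _ := by gcongr
    _ ≤ _ := le_markovConvexity_cantor hq i

open Filter Asymptotics in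
theorem exists_lt_lpDistortion {p : ℝ} (hp : 1 < p) {c : ℝ} (hc : 1 < c) {g : ℕ → ℝ}
    (hg : g =o[atTop] (fun k : ℕ => (k : ℝ) ^ (min (1 / p) (1 / 2)))) :
    ∃ i k : ℕ, binaryDepth (Cantor i) c = k ∧
      ENNReal.ofReal (g k) < lpDistortion p (Cantor i) := by
  obtain ⟨κ, hκ, hκp⟩ := markovConvexity_le_lpDistortion hp
  obtain ⟨K, hK⟩ := binaryDepth_cantor_le hc
  have hq : (0 : ℝ) < max 2 p := lt_max_of_lt_left (by norm_num)
  rw [min_one_div_eq hp] at hg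
  set θ := 1 / max 2 p with hθ
  have hθ0 : 0 < θ := by positivity
  set η : ℝ := κ * (1 / 8) ^ θ with hη
  have hη0 : 0 < η := mul_pos (by exact_mod_cast hκ) (by positivity)
  -- Chosen so that ε·(K·i)^θ takes up at most half of the lower bound η·i^θ for the distortion.
  set ε : ℝ := η / (2 * ((K : ℝ) ^ θ + 1)) with hε
  have hK0 : 0 ≤ (K : ℝ) ^ θ := by positivity
  have hε0 : 0 < ε := by positivity
  have hεK : ε * (K : ℝ) ^ θ ≤ η / 2 := by
    rw [hε, div_mul_eq_mul_div, div_le_div_iff₀ (by positivity) (by norm_num)]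
    nlinarith
  obtain ⟨N, hN⟩ := eventually_atTop.1 (hg.def hε0)
  -- The depth is not known to tend to infinity with i, so the values of g below N are absorbed into
  -- a constant.
  obtain ⟨M, hM0, hM⟩ : ∃ M : ℝ, 0 ≤ M ∧ ∀ k : ℕ, g k ≤ M + ε * (k : ℝ) ^ θ := by
    refine ⟨∑ k ∈ Finset.range N, |g k|, Finset.sum_nonneg fun _ _ => abs_nonneg _, fun k => ?_⟩
    rcases Nat.lt_or_ge k N with h | h
    · have h1 := Finset.single_le_sum (f := fun k => |g k|) (fun _ _ => abs_nonneg _)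
        (Finset.mem_range.2 h)
      have h2 : 0 ≤ ε * (k : ℝ) ^ θ := by positivity
      have h3 := le_abs_self (g k)
      linarith
    · have h1 := hN k h
      rw [Real.norm_eq_abs, Real.norm_of_nonneg (by positivity)] at h1
      have h2 : 0 ≤ ∑ k ∈ Finset.range N, |g k| := Finset.sum_nonneg fun _ _ => abs_nonneg _
      have h3 := le_abs_self (g k)
      linarith
  obtain ⟨i, hi⟩ : ∃ i : ℕ, M < η / 2 * (i : ℝ) ^ θ := by
    have h1 : Tendsto (fun i : ℕ => η / 2 * (i : ℝ) ^ θ) atTop atTop :=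
      ((tendsto_rpow_atTop hθ0).comp tendsto_natCast_atTop_atTop).const_mul_atTop (by positivity)
    exact (h1.eventually_gt_atTop M).exists
  obtain ⟨k, hk⟩ := ENat.ne_top_iff_exists.1 (ne_top_of_le_ne_top (ENat.natCast_ne_top _) (hK i))
  refine ⟨i, k, hk.symm, ?_⟩
  have hkK : k ≤ K * i := by
    have := hK i
    rw [← hk] at this
    exact_mod_cast this
  have hgk : g k < η * (i : ℝ) ^ θ := by
    have h1 : (k : ℝ) ^ θ ≤ (K : ℝ) ^ θ * (i : ℝ) ^ θ := by
      rw [← Real.mul_rpow (Nat.cast_nonneg _) (Nat.cast_nonneg _)]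
      exact Real.rpow_le_rpow (Nat.cast_nonneg _) (by exact_mod_cast hkK) hθ0.le
    have h2 := mul_le_mul_of_nonneg_left h1 hε0.le
    have h3 : ε * (K : ℝ) ^ θ * (i : ℝ) ^ θ ≤ η / 2 * (i : ℝ) ^ θ :=
      mul_le_mul_of_nonneg_right hεK (by positivity)
    have h4 := hM k
    linarith
  have hpos : 0 < η * (i : ℝ) ^ θ := by
    have : 0 < η / 2 * (i : ℝ) ^ θ := hM0.trans_lt hi
    linarith
  calc ENNReal.ofReal (g k) < ENNReal.ofReal (η * (i : ℝ) ^ θ) :=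
        (ENNReal.ofReal_lt_ofReal_iff hpos).2 hgk
    _ = (κ : ℝ≥0∞) * (((1 / 8 : ℝ≥0) : ℝ≥0∞) * i) ^ θ := by
        rw [hη, mul_assoc, ← Real.mul_rpow (by norm_num) (Nat.cast_nonneg _),
          ENNReal.ofReal_mul (NNReal.coe_nonneg _), ENNReal.ofReal_coe_nnreal,
          ← ENNReal.ofReal_rpow_of_nonneg (by positivity) hθ0.le,
          ENNReal.ofReal_mul (by norm_num), ENNReal.ofReal_natCast]
        congr 3
        rw [ENNReal.ofReal, Real.toNNReal_div (by norm_num)]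
        norm_num
    _ ≤ (κ : ℝ≥0∞) * markovConvexity (max 2 p) (Cantor i) :=
        mul_le_mul_right (le_markovConvexity_cantor hq i) _
    _ ≤ _ := hκp (Cantor i)

end CantorTree

end

open CantorTree Filter Asymptotics in
theorem claim3 :
    -- the trees grow
    Tendsto (fun i => Nat.card (Cantor i)) atTop atTop ∧
    -- they are weak prototypes (unit edge lengths, height ratio one)
    (∀ i : ℕ, 2 ≤ i →
      IsWeakPrototype (SST.graph (cantorDegrees i)) (SST.root (cantorDegrees i)) (fun _ => 1)
        (1 / 2) ((2 : ℝ) ^ (-(i : ℝ) / 3)) 1) ∧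
    -- their Markov convexity constants are at least of order `i ^ (1 / p)`
    (∃ κ : ℝ≥0, 0 < κ ∧ ∀ p : ℝ, 0 < p → ∀ i : ℕ,
      ((κ : ℝ≥0∞) * i) ^ (1 / p) ≤ markovConvexity p (Cantor i)) ∧
    -- they contain only binary trees of depth `O(i)`
    (∀ c : ℝ, 1 < c → ∃ K : ℝ≥0, ∀ i : ℕ,
      (binaryDepth (Cantor i) c : ℝ≥0∞) ≤ (K : ℝ≥0∞) * i) ∧
    -- the chain of inequalities between distortion, Markov convexity and binary depth
    (∀ p : ℝ, 1 < p → ∃ κ : ℝ≥0, 0 < κ ∧ ∀ i : ℕ,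
      (κ : ℝ≥0∞) * markovConvexity (max 2 p) (Cantor i) ≤ lpDistortion p (Cantor i)) ∧
    (∀ c : ℝ, 1 < c → ∃ κ : ℝ≥0, 0 < κ ∧ ∀ p : ℝ, 1 < p → ∀ i : ℕ,
      (κ : ℝ≥0∞) * (binaryDepth (Cantor i) c : ℝ≥0∞) ^ (min (1 / p) (1 / 2)) ≤
        markovConvexity (max 2 p) (Cantor i)) ∧
    (∀ p : ℝ, 1 < p → ∀ c : ℝ, 1 < c → ∃ κ : ℝ≥0, 0 < κ ∧ ∀ i : ℕ,
      (κ : ℝ≥0∞) * (binaryDepth (Cantor i) c : ℝ≥0∞) ^ (min (1 / p) (1 / 2)) ≤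
        lpDistortion p (Cantor i)) ∧
    -- no upper bound on the distortion by a function of the binary depth of smaller order holds
    (∀ p : ℝ, 1 < p → ∀ c : ℝ, 1 < c → ∀ g : ℕ → ℝ,
      g =o[atTop] (fun k : ℕ => (k : ℝ) ^ (min (1 / p) (1 / 2))) →
      ∃ i k : ℕ, binaryDepth (Cantor i) c = k ∧
        ENNReal.ofReal (g k) < lpDistortion p (Cantor i)) := by
  refine ⟨tendsto_card_cantor, fun i hi => isWeakPrototype_cantor hi,
    ⟨1 / 8, by norm_num, fun p hp i => le_markovConvexity_cantor hp i⟩,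
    fun c hc => binaryDepth_cantor_le_mul hc, fun p hp => ?_,
    fun c hc => binaryDepth_rpow_le_markovConvexity hc, fun p hp c hc => ?_,
    fun p hp c hc g hg => exists_lt_lpDistortion hp hc hg⟩
  · obtain ⟨κ, hκ, h⟩ := markovConvexity_le_lpDistortion hp
    exact ⟨κ, hκ, fun i => h (Cantor i)⟩
  · obtain ⟨κ, hκ, h⟩ := markovConvexity_le_lpDistortion hp
    obtain ⟨κ', hκ', h'⟩ := binaryDepth_rpow_le_markovConvexity hc
    refine ⟨κ * κ', mul_pos hκ hκ', fun i => ?_⟩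
    rw [ENNReal.coe_mul, mul_assoc]
    exact (mul_le_mul_right (h' p hp i) _).trans (h (Cantor i))
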